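/- For an open set $U\subset\mathbb C$, let $W^{1,2}(U)$ be the space of real-valued functions $f\in L^2(U)$ with weak gradient $\nabla f\in L^2(U)$, with norm $\|f\|_{L^2(U)}+\|\nabla f\|_{L^2(U)}$, and let $W^{1,2}_0(U)$ be the closure of $C_0^\infty(U)$ in $W^{1,2}(U)$. A real number $\lambda$ is a Dirichlet eigenvalue of $U$ if there is $g\in W^{1,2}_0(U)$, $g\neq 0$, with $\int_U\nabla g\cdot\nabla v\,dx\,dy=\lambda\int_U g\,v\,dx\,dy$ for all $v\in W_0^{1,2}(U)$. Let $\Omega\subset\mathbb C$ be a bounded simply connected domain, let $\mathbb D$ be the open unit disc, let $\varphi:\mathbb D\to\Omega$ be a conformal mapping (a holomorphic bijection) and let $h=|\varphi'|^2$. Then $\Omega$ has a smallest Dirichlet eigenvalue $\lambda_1[\Omega]$, it is positive, and: 1. every $f\in W_0^{1,2}(\mathbb D)$ belongs to the weighted space $L^2(\mathbb D,h)$, with norm $\|f\|_{L^2(\mathbb D,h)}=\left(\int_{\mathbb D}|f|^2h\,dx\,dy\right)^{1/2}$, and the embedding operator $W_0^{1,2}(\mathbb D)\hookrightarrow L^2(\mathbb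 D,h)$ is bounded and compact; 2. for every $f\in W_0^{1,2}(\mathbb D)$, $$\|f\|_{L^2(\mathbb D,h)}\le K^*\,\|\nabla f\|_{L^2(\mathbb D)},\qquad K^*=\frac1{\sqrt{\lambda_1[\Omega]}},$$ and $K^*$ is the smallest constant for which this holds; 3. the same $K^*$ is the smallest constant $K$ such that $\|g\|_{L^2(\Omega)}\le K\|\nabla g\|_{L^2(\Omega)}$ for all $g\in W_0^{1,2}(\Omega)$. -/

import Mathlib

open MeasureTheory Set
open scoped Topology Gradient ContDiff

noncomputable section

namespace PlaneSobolev

/-- Real-valued test functions on an open set `Ω ⊆ ℂ ≅ ℝ²`, i.e. the space `C₀^∞(Ω)`. -/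
structure IsTest (Ω : Set ℂ) (η : ℂ → ℝ) : Prop where
  smooth : ContDiff ℝ ∞ η
  compact : HasCompactSupport η
  supp : tsupport η ⊆ Ω

theorem IsTest.zero (Ω : Set ℂ) : IsTest Ω 0 :=
  ⟨contDiff_const, HasCompactSupport.zero, by simp⟩

theorem IsTest.add {Ω : Set ℂ} {η θ : ℂ → ℝ} (hη : IsTest Ω η) (hθ : IsTest Ω θ) :
    IsTest Ω (η + θ) :=
  ⟨hη.smooth.add hθ.smooth, hη.compact.add hθ.compact,
    (tsupport_add η θ).trans (union_subset hη.supp hθ.supp)⟩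

theorem IsTest.const_smul {Ω : Set ℂ} {η : ℂ → ℝ} (c : ℝ) (hη : IsTest Ω η) :
    IsTest Ω (c • η) :=
  ⟨hη.smooth.const_smul c, hη.compact.smul_left (f := fun _ => c),
    (closure_mono (Function.support_const_smul_subset c η)).trans hη.supp⟩

theorem IsTest.continuous_gradient {Ω : Set ℂ} {η : ℂ → ℝ} (hη : IsTest Ω η) :
    Continuous (∇ η) :=
  (InnerProductSpace.toDual ℝ ℂ).symm.continuous.comp
    (hη.smooth.continuous_fderiv (by simp))

theorem IsTest.hasCompactSupport_gradient {Ω : Set ℂ} {η : ℂ → ℝ} (hη : IsTest Ω η) :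
    HasCompactSupport (∇ η) :=
  (hη.compact.fderiv (𝕜 := ℝ)).comp_left (g := (InnerProductSpace.toDual ℝ ℂ).symm)
    (map_zero _)

/-- `F` is the weak gradient of `f` on `Ω`: `∫_Ω f ∇η = - ∫_Ω η F` for all test functions `η`.
Gradients take values in `ℂ ≅ ℝ²`: the complex number `a + i b` stands for the vector `(a, b)`. -/
def HasWeakGradient (Ω : Set ℂ) (f : ℂ → ℝ) (F : ℂ → ℂ) : Prop :=
  ∀ η : ℂ → ℝ, IsTest Ω η →
    ∫ z in Ω, f z • ∇ η z = - ∫ z in Ω, η z • F z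

/-- `L²(Ω)`, real-valued functions. -/
abbrev L2 (Ω : Set ℂ) : Type := Lp ℝ 2 (volume.restrict Ω)

/-- `L²(Ω; ℝ²)`, vector fields. -/
abbrev L2Vec (Ω : Set ℂ) : Type := Lp ℂ 2 (volume.restrict Ω)

theorem integrable_smul_gradient {Ω : Set ℂ} (f : L2 Ω) {η : ℂ → ℝ} (hη : IsTest Ω η) :
    Integrable (fun z => f z • ∇ η z) (volume.restrict Ω) :=
  memLp_one_iff_integrable.1 <| MemLp.smul (p := 2) (q := 2)
    (hη.continuous_gradient.memLp_of_hasCompactSupport hη.hasCompactSupport_gradient)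
    (Lp.memLp f)

theorem integrable_smul_field {Ω : Set ℂ} (F : L2Vec Ω) {η : ℂ → ℝ} (hη : IsTest Ω η) :
    Integrable (fun z => η z • F z) (volume.restrict Ω) :=
  memLp_one_iff_integrable.1 <| MemLp.smul (p := 2) (q := 2) (Lp.memLp F)
    (hη.smooth.continuous.memLp_of_hasCompactSupport hη.compact)

/-- The Sobolev space `W^{1,2}(Ω)`: functions `f ∈ L²(Ω)` with weak gradient `F ∈ L²(Ω)`, recorded
as pairs `(f, F)` (`F` is determined by `f`). The norm is `‖f‖_{L²} + ‖∇f‖_{L²}`. -/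
def W12 (Ω : Set ℂ) : Submodule ℝ (WithLp 1 (L2 Ω × L2Vec Ω)) where
  carrier := {u | HasWeakGradient Ω u.fst u.snd}
  zero_mem' := by
    intro η _
    have h1 : (fun z => (0 : L2 Ω) z • ∇ η z) =ᵐ[volume.restrict Ω] fun _ => 0 := by
      filter_upwards [Lp.coeFn_zero ℝ 2 (volume.restrict Ω)] with z hz
      rw [hz, Pi.zero_apply, zero_smul]
    have h2 : (fun z => η z • (0 : L2Vec Ω) z) =ᵐ[volume.restrict Ω] fun _ => 0 := by
      filter_upwards [Lp.coeFn_zero ℂ 2 (volume.restrict Ω)] with z hz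
      rw [hz, Pi.zero_apply, smul_zero]
    change ∫ z in Ω, (0 : L2 Ω) z • ∇ η z = - ∫ z in Ω, η z • (0 : L2Vec Ω) z
    rw [integral_congr_ae h1, integral_congr_ae h2]
    simp
  add_mem' := by
    intro u v hu hv η hη
    have h1 : (fun z => (u.fst + v.fst : L2 Ω) z • ∇ η z) =ᵐ[volume.restrict Ω]
        fun z => u.fst z • ∇ η z + v.fst z • ∇ η z := by
      filter_upwards [Lp.coeFn_add u.fst v.fst] with z hz
      rw [hz, Pi.add_apply, add_smul]
    have h2 : (fun z => η z • (u.snd + v.snd : L2Vec Ω) z) =ᵐ[volume.restrict Ω]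
        fun z => η z • u.snd z + η z • v.snd z := by
      filter_upwards [Lp.coeFn_add u.snd v.snd] with z hz
      rw [hz, Pi.add_apply, smul_add]
    change ∫ z in Ω, (u.fst + v.fst : L2 Ω) z • ∇ η z
      = - ∫ z in Ω, η z • (u.snd + v.snd : L2Vec Ω) z
    rw [integral_congr_ae h1, integral_congr_ae h2,
      integral_add (integrable_smul_gradient _ hη) (integrable_smul_gradient _ hη),
      integral_add (integrable_smul_field _ hη) (integrable_smul_field _ hη),
      hu η hη, hv η hη, neg_add]
  smul_mem' := by
    intro c u hu η hη
    have h1 : (fun z => (c • u.fst : L2 Ω) z • ∇ η z) =ᵐ[volume.restrict Ω]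
        fun z => c • (u.fst z • ∇ η z) := by
      filter_upwards [Lp.coeFn_smul c u.fst] with z hz
      rw [hz, Pi.smul_apply, smul_assoc]
    have h2 : (fun z => η z • (c • u.snd : L2Vec Ω) z) =ᵐ[volume.restrict Ω]
        fun z => c • (η z • u.snd z) := by
      filter_upwards [Lp.coeFn_smul c u.snd] with z hz
      rw [hz, Pi.smul_apply, smul_comm]
    change ∫ z in Ω, (c • u.fst : L2 Ω) z • ∇ η z
      = - ∫ z in Ω, η z • (c • u.snd : L2Vec Ω) z
    rw [integral_congr_ae h1, integral_congr_ae h2, integral_smul, integral_smul,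
      hu η hη, smul_neg]

/-- The subspace `C₀^∞(Ω)` of `W^{1,2}(Ω)`. -/
def testSubmodule (Ω : Set ℂ) : Submodule ℝ (W12 Ω) where
  carrier := {u | ∃ η, IsTest Ω η ∧ u.1.fst =ᵐ[volume.restrict Ω] η}
  zero_mem' := ⟨0, IsTest.zero Ω, Lp.coeFn_zero ℝ 2 (volume.restrict Ω)⟩
  add_mem' := by
    rintro u v ⟨η, hη, hu⟩ ⟨θ, hθ, hv⟩
    exact ⟨η + θ, hη.add hθ, (Lp.coeFn_add u.1.fst v.1.fst).trans (hu.add hv)⟩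
  smul_mem' := by
    rintro c u ⟨η, hη, hu⟩
    exact ⟨c • η, hη.const_smul c, (Lp.coeFn_smul c u.1.fst).trans (hu.const_smul c)⟩

/-- `W₀^{1,2}(Ω)`: the closure of `C₀^∞(Ω)` in `W^{1,2}(Ω)`. -/
def W012 (Ω : Set ℂ) : Submodule ℝ (W12 Ω) := (testSubmodule Ω).topologicalClosure

/-- The underlying function of an element of `W₀^{1,2}(Ω)`, as an element of `L²(Ω)`. -/
def W012.fn {Ω : Set ℂ} (u : W012 Ω) : L2 Ω := u.1.1.fst

/-- The weak gradient of an element of `W₀^{1,2}(Ω)`; its norm is the seminorm of `L^{1,2}(Ω)`. -/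
def W012.grad {Ω : Set ℂ} (u : W012 Ω) : L2Vec Ω := u.1.1.snd

/-- `μ` is an eigenvalue of the Dirichlet Laplacian on `Ω` (weak formulation). -/
def IsDirichletEigenvalue (Ω : Set ℂ) (μ : ℝ) : Prop :=
  ∃ g : W012 Ω, g ≠ 0 ∧ ∀ v : W012 Ω,
    ∫ z in Ω, inner ℝ (W012.grad g z) (W012.grad v z)
      = μ * ∫ z in Ω, W012.fn g z * W012.fn v z

/-- The first eigenvalue `λ₁[Ω]` of the Dirichlet Laplacian on `Ω`. -/
def lambda1 (Ω : Set ℂ) : ℝ := sInf {μ | IsDirichletEigenvalue Ω μ}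

/-- The open unit disc. -/
abbrev disc : Set ℂ := Metric.ball 0 1

/-- The measure `h dx dy` on the unit disc with the conformal weight `h = |φ'|²`. -/
def weightedMeasure (φ : ℂ → ℂ) : Measure ℂ :=
  (volume.restrict disc).withDensity fun z => ENNReal.ofReal (‖deriv φ z‖ ^ 2)

/-- The weighted space `L²(𝔻, h)`, `h = |φ'|²`. -/
abbrev L2Weighted (φ : ℂ → ℂ) : Type := Lp ℝ 2 (weightedMeasure φ)

/-- `φ` maps the unit disc conformally (holomorphically and bijectively) onto `Ω`. -/
structure IsConformalOnto (φ : ℂ → ℂ) (Ω : Set ℂ) : Prop where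
  holo : DifferentiableOn ℂ φ disc
  bij : BijOn φ disc Ω

end PlaneSobolev

end

open PlaneSobolev

namespace PlaneSobolev

/-! Composition with `φ` turns the weighted problem on the disc into the unweighted one on `Ω`. The
gradient of `g ∘ φ` is `|φ'|` times as long as that of `g`, and `φ` multiplies area by `|φ'|²`, so
the two functions have the same Dirichlet integral (`norm_grad_eq`). The same Jacobian shows that
`φ` pushes `h dx dy` forward to Lebesgue measure on `Ω` (`measurePreserving`), so `g ∘ φ` has in
`L²(𝔻, h)` the norm that `g` has in `L²(Ω)`. The embedding therefore factors as `W₀^{1,2}(𝔻) →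
W₀^{1,2}(Ω) → L²(Ω) → L²(𝔻, h)`, where the first map preserves the gradient norm and the last is an
isometry. The first map is built on test functions and extended by completeness, the Poincaré
inequality on `Ω` making the images Cauchy (`exists_push`). Sharpness needs only the pull-back of
test functions.

On `Ω` everything rests on `‖u(· + h) - u‖ ≤ |h| ‖∇u‖`. A translation moving `Ω` off itself gives
Poincaré (`exists_poincare_const`); approximation by averages over small squares, a finite-rank
operator, gives Rellich (`isCompactOperator_fnL`). The inclusion into `L²(Ω)` composed with the
inverse of the gradient on its closed range is then a compact operator `J` between Hilbert spaces.
Its norm is the best Poincaré constant and is attained at an eigenvector of `J* J`. The eigenvector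
equation is the weak Dirichlet problem with eigenvalue `‖J‖⁻²`, and testing any eigenfunction
against itself shows that no eigenvalue is smaller (`exists_isLeast_poincare`). -/

/-! ### Test functions and uniqueness of weak gradients -/

theorem norm_gradient_eq (η : ℂ → ℝ) (z : ℂ) : ‖∇ η z‖ = ‖fderiv ℝ η z‖ := by
  simp [gradient]

theorem IsTest.memLp {Ω : Set ℂ} {η : ℂ → ℝ} (hη : IsTest Ω η) (μ : Measure ℂ)
    [IsFiniteMeasureOnCompacts μ] : MemLp η 2 μ :=
  hη.smooth.continuous.memLp_of_hasCompactSupport hη.compact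

theorem IsTest.memLp_gradient {Ω : Set ℂ} {η : ℂ → ℝ} (hη : IsTest Ω η) (μ : Measure ℂ)
    [IsFiniteMeasureOnCompacts μ] : MemLp (∇ η) 2 μ :=
  hη.continuous_gradient.memLp_of_hasCompactSupport hη.hasCompactSupport_gradient

theorem IsTest.eq_zero_of_notMem {Ω : Set ℂ} {η : ℂ → ℝ} (hη : IsTest Ω η) {z : ℂ}
    (hz : z ∉ Ω) : η z = 0 :=
  image_eq_zero_of_notMem_tsupport fun h => hz (hη.supp h)

theorem IsTest.gradient_eq_zero_of_notMem {Ω : Set ℂ} {η : ℂ → ℝ} (hη : IsTest Ω η) {z : ℂ}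
    (hz : z ∉ Ω) : ∇ η z = 0 := by
  have : fderiv ℝ η z = 0 :=
    Function.notMem_support.1 fun h => hz (hη.supp (support_fderiv_subset ℝ h))
  simp [gradient, this]

theorem IsTest.integrable_mul_fderiv {Ω Ω' : Set ℂ} {η θ : ℂ → ℝ} (hη : IsTest Ω η)
    (hθ : IsTest Ω' θ) (v : ℂ) : Integrable (fun z => η z * fderiv ℝ θ z v) := by
  refine Continuous.integrable_of_hasCompactSupport ?_ hη.compact.mul_right
  exact hη.smooth.continuous.mul
    ((hθ.smooth.continuous_fderiv (by simp)).clm_apply continuous_const)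

/-- The classical gradient of a test function is its weak gradient. -/
theorem IsTest.hasWeakGradient {Ω Ω' : Set ℂ} {η : ℂ → ℝ} (hη : IsTest Ω' η) :
    HasWeakGradient Ω η (∇ η) := by
  intro θ hθ
  rw [setIntegral_eq_integral_of_forall_compl_eq_zero fun z hz => by
      rw [hθ.gradient_eq_zero_of_notMem hz, smul_zero],
    setIntegral_eq_integral_of_forall_compl_eq_zero fun z hz => by
      rw [hθ.eq_zero_of_notMem hz, zero_smul]]
  have i1 : Integrable (fun z => η z • ∇ θ z) :=
    (hη.smooth.continuous.smul hθ.continuous_gradient).integrable_of_hasCompactSupport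
      hη.compact.smul_right
  have i2 : Integrable (fun z => θ z • ∇ η z) :=
    (hθ.smooth.continuous.smul hη.continuous_gradient).integrable_of_hasCompactSupport
      hθ.compact.smul_right
  -- Pairing with a fixed vector `v` reduces the claim to integration by parts for the derivative in
  -- direction `v` over the whole plane.
  refine ext_inner_left ℝ fun v => ?_
  rw [inner_neg_right, ← integral_inner i1, ← integral_inner i2]
  have e : ∀ (f : ℂ → ℝ) (z : ℂ), inner ℝ v (∇ f z) = fderiv ℝ f z v := fun f z => by
    rw [real_inner_comm, gradient, InnerProductSpace.toDual_symm_apply]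
  simp only [real_inner_smul_right, e]
  have i3 := hη.integrable_mul_fderiv hθ v
  have i4 := hθ.integrable_mul_fderiv hη v
  rw [integral_mul_fderiv_eq_neg_fderiv_mul_of_integrable (by simpa only [mul_comm] using i4) i3
    ((hη.smooth.continuous.mul hθ.smooth.continuous).integrable_of_hasCompactSupport
      hη.compact.mul_right)
    (fun _ _ => hη.smooth.differentiable (by simp) _)
    (fun _ _ => hθ.smooth.differentiable (by simp) _)]
  simp only [mul_comm]

theorem HasWeakGradient.congr_ae {Ω : Set ℂ} {f g : ℂ → ℝ} {F G : ℂ → ℂ}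
    (h : HasWeakGradient Ω f F) (hf : f =ᵐ[volume.restrict Ω] g)
    (hF : F =ᵐ[volume.restrict Ω] G) : HasWeakGradient Ω g G := by
  intro η hη
  have h1 : (fun z => g z • ∇ η z) =ᵐ[volume.restrict Ω] fun z => f z • ∇ η z := by
    filter_upwards [hf] with z hz
    rw [hz]
  have h2 : (fun z => η z • G z) =ᵐ[volume.restrict Ω] fun z => η z • F z := by
    filter_upwards [hF] with z hz
    rw [hz]
  rw [integral_congr_ae h1, integral_congr_ae h2, h η hη]

/-- Weak gradients are unique. -/
theorem HasWeakGradient.ae_eq {Ω : Set ℂ} (hΩ : IsOpen Ω) {f : ℂ → ℝ} {F G : ℂ → ℂ}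
    (hF : HasWeakGradient Ω f F) (hG : HasWeakGradient Ω f G)
    (hF2 : MemLp F 2 (volume.restrict Ω)) (hG2 : MemLp G 2 (volume.restrict Ω)) :
    F =ᵐ[volume.restrict Ω] G := by
  have key : ∀ᵐ z, z ∈ Ω → (F - G) z = 0 := by
    refine hΩ.ae_eq_zero_of_integral_contDiff_smul_eq_zero ?_ ?_
    · rw [locallyIntegrableOn_iff hΩ.isLocallyClosed]
      intro k hk hkc
      have : MemLp (F - G) 2 (volume.restrict k) :=
        (hF2.sub hG2).mono_measure (Measure.restrict_mono hk le_rfl)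
      have : IsFiniteMeasure (volume.restrict k : Measure ℂ) :=
        ⟨by simpa using hkc.measure_lt_top⟩
      exact MemLp.integrable (by norm_num) ‹MemLp (F - G) 2 (volume.restrict k)›
    · intro η h1 h2 h3
      have hη : IsTest Ω η := ⟨h1, h2, h3⟩
      rw [← setIntegral_eq_integral_of_forall_compl_eq_zero (s := Ω) fun z hz => by
        rw [hη.eq_zero_of_notMem hz, zero_smul]]
      have iF : Integrable (fun z => η z • F z) (volume.restrict Ω) :=
        memLp_one_iff_integrable.1 <| MemLp.smul (p := 2) (q := 2) hF2 (hη.memLp _)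
      have iG : Integrable (fun z => η z • G z) (volume.restrict Ω) :=
        memLp_one_iff_integrable.1 <| MemLp.smul (p := 2) (q := 2) hG2 (hη.memLp _)
      simp only [Pi.sub_apply, smul_sub]
      rw [integral_sub iF iG, sub_eq_zero, ← neg_inj, ← hF η hη, hG η hη]
  filter_upwards [(ae_restrict_iff' hΩ.measurableSet).2 key] with z hz
  exact sub_eq_zero.1 hz

/-! ### The Banach space `W₀^{1,2}(Ω)` and density arguments -/

/-- The element of `W₀^{1,2}(Ω)` given by a test function. -/
noncomputable def IsTest.toW012 {Ω : Set ℂ} {η : ℂ → ℝ} (hη : IsTest Ω η) : W012 Ω :=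
  ⟨⟨WithLp.toLp 1 ((hη.memLp (volume.restrict Ω)).toLp η,
      (hη.memLp_gradient (volume.restrict Ω)).toLp (∇ η)),
    hη.hasWeakGradient.congr_ae (hη.memLp _).coeFn_toLp.symm
      (hη.memLp_gradient _).coeFn_toLp.symm⟩,
    (testSubmodule Ω).le_topologicalClosure ⟨η, hη, (hη.memLp _).coeFn_toLp⟩⟩

theorem IsTest.fn_toW012 {Ω : Set ℂ} {η : ℂ → ℝ} (hη : IsTest Ω η) :
    W012.fn hη.toW012 = (hη.memLp (volume.restrict Ω)).toLp η := rfl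

theorem IsTest.grad_toW012 {Ω : Set ℂ} {η : ℂ → ℝ} (hη : IsTest Ω η) :
    W012.grad hη.toW012 = (hη.memLp_gradient (volume.restrict Ω)).toLp (∇ η) := rfl

/-- Uniqueness of weak gradients makes the second component redundant. This identifies a member of
`testSubmodule` with the element built from its smooth representative. -/
theorem W12.ext_fst {Ω : Set ℂ} (hΩ : IsOpen Ω) {u v : W12 Ω} (h : u.1.fst = v.1.fst) :
    u = v := by
  have h2 : u.1.snd = v.1.snd := by
    refine Lp.ext (HasWeakGradient.ae_eq hΩ (f := u.1.fst) u.2 ?_ (Lp.memLp _) (Lp.memLp _))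
    rw [h]
    exact v.2
  refine Subtype.ext ((WithLp.ofLp_injective 1) (Prod.ext h h2))

theorem IsTest.toW012_sub {Ω : Set ℂ} (hΩ : IsOpen Ω) {η θ : ℂ → ℝ} (hη : IsTest Ω η)
    (hθ : IsTest Ω θ) (h : IsTest Ω (η - θ)) : hη.toW012 - hθ.toW012 = h.toW012 :=
  Subtype.ext (W12.ext_fst hΩ (MemLp.toLp_sub (hη.memLp _) (hθ.memLp _)).symm)

theorem IsTest.sub {Ω : Set ℂ} {η θ : ℂ → ℝ} (hη : IsTest Ω η) (hθ : IsTest Ω θ) :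
    IsTest Ω (η - θ) := by
  rw [sub_eq_add_neg, ← neg_one_smul ℝ θ]
  exact hη.add (hθ.const_smul (-1))

/-- Test functions are dense in `W₀^{1,2}(Ω)`. -/
theorem W012.exists_seq_test {Ω : Set ℂ} (hΩ : IsOpen Ω) (u : W012 Ω) :
    ∃ (η : ℕ → ℂ → ℝ) (hη : ∀ n, IsTest Ω (η n)),
      Filter.Tendsto (fun n => (hη n).toW012) Filter.atTop (𝓝 u) := by
  obtain ⟨x, hx, hlim⟩ := mem_closure_iff_seq_limit.1
    (show (u : W12 Ω) ∈ closure (testSubmodule Ω : Set (W12 Ω)) from u.2)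
  choose η hη hxη using hx
  refine ⟨η, hη, tendsto_subtype_rng.2 ?_⟩
  convert hlim using 2 with n
  refine W12.ext_fst hΩ (Lp.ext ?_)
  exact ((hη n).memLp _).coeFn_toLp.trans (hxη n).symm

/-- The inclusion `W₀^{1,2}(Ω) → L²(Ω)`. -/
noncomputable def W012.fnL (Ω : Set ℂ) : W012 Ω →L[ℝ] L2 Ω :=
  (WithLp.fstL 1 ℝ (L2 Ω) (L2Vec Ω)).comp ((W12 Ω).subtypeL.comp (W012 Ω).subtypeL)

/-- The weak gradient `W₀^{1,2}(Ω) → L²(Ω; ℝ²)`. -/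
noncomputable def W012.gradL (Ω : Set ℂ) : W012 Ω →L[ℝ] L2Vec Ω :=
  (WithLp.sndL 1 ℝ (L2 Ω) (L2Vec Ω)).comp ((W12 Ω).subtypeL.comp (W012 Ω).subtypeL)

@[simp] theorem W012.fnL_apply {Ω : Set ℂ} (u : W012 Ω) : W012.fnL Ω u = W012.fn u := rfl

@[simp] theorem W012.gradL_apply {Ω : Set ℂ} (u : W012 Ω) : W012.gradL Ω u = W012.grad u := rfl

theorem W012.norm_eq {Ω : Set ℂ} (u : W012 Ω) : ‖u‖ = ‖W012.fn u‖ + ‖W012.grad u‖ :=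
  WithLp.prod_norm_eq_of_L1 _

/-- A closed relation between `fn` and `grad` that holds for test functions holds on
`W₀^{1,2}(Ω)`. -/
theorem W012.induction_test {Ω : Set ℂ} (hΩ : IsOpen Ω) {p : W012 Ω → Prop}
    (hp : IsClosed {u | p u}) (h : ∀ (η : ℂ → ℝ) (hη : IsTest Ω η), p hη.toW012)
    (u : W012 Ω) : p u := by
  obtain ⟨η, hη, hlim⟩ := W012.exists_seq_test hΩ u
  exact hp.mem_of_tendsto hlim (Filter.Eventually.of_forall fun n => h _ (hη n))

/-- For each test function, both sides of the defining identity are continuous in the pair, being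
pairings with a fixed `L²` function or field; the space is an intersection of equalizers. -/
theorem isClosed_W12 (Ω : Set ℂ) : IsClosed (W12 Ω : Set (WithLp 1 (L2 Ω × L2Vec Ω))) := by
  have : (W12 Ω : Set (WithLp 1 (L2 Ω × L2Vec Ω))) =
      ⋂ (η : ℂ → ℝ) (_ : IsTest Ω η),
        {u | ∫ z in Ω, u.fst z • ∇ η z = - ∫ z in Ω, η z • u.snd z} := by
    ext u
    simp only [mem_iInter]
    rfl
  rw [this]
  refine isClosed_iInter fun η => isClosed_iInter fun hη => isClosed_eq ?_ (Continuous.neg ?_)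
  · have hc := ((((ContinuousLinearMap.lsmul ℝ ℝ (E := ℂ)).lpPairing (volume.restrict Ω) 2 2).flip
      ((hη.memLp_gradient (volume.restrict Ω)).toLp (∇ η))).comp
      (WithLp.fstL 1 ℝ (L2 Ω) (L2Vec Ω))).continuous
    refine hc.congr fun u => ?_
    simp only [ContinuousLinearMap.comp_apply, ContinuousLinearMap.flip_apply,
      ContinuousLinearMap.lpPairing_eq_integral]
    refine integral_congr_ae ?_
    filter_upwards [(hη.memLp_gradient (volume.restrict Ω)).coeFn_toLp] with z hz
    rw [hz]
    rfl
  · have hc := ((((ContinuousLinearMap.lsmul ℝ ℝ (E := ℂ)).lpPairing (volume.restrict Ω) 2 2)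
      ((hη.memLp (volume.restrict Ω)).toLp η)).comp
      (WithLp.sndL 1 ℝ (L2 Ω) (L2Vec Ω))).continuous
    refine hc.congr fun u => ?_
    simp only [ContinuousLinearMap.comp_apply, ContinuousLinearMap.lpPairing_eq_integral]
    refine integral_congr_ae ?_
    filter_upwards [(hη.memLp (volume.restrict Ω)).coeFn_toLp] with z hz
    rw [hz]
    rfl

instance W12.instCompleteSpace (Ω : Set ℂ) : CompleteSpace (W12 Ω) :=
  (isClosed_W12 Ω).completeSpace_coe

instance W012.instCompleteSpace (Ω : Set ℂ) : CompleteSpace (W012 Ω) :=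
  (testSubmodule Ω).isClosed_topologicalClosure.completeSpace_coe

/-! ### Translation estimates and the Poincaré inequality -/

open scoped ENNReal

/-- Jensen's inequality for the square. -/
theorem sq_lintegral_le {α : Type*} [MeasurableSpace α] (μ : Measure α) {f : α → ℝ≥0∞}
    (hf : AEMeasurable f μ) : (∫⁻ x, f x ∂μ) ^ 2 ≤ μ univ * ∫⁻ x, f x ^ 2 ∂μ := by
  have h := ENNReal.lintegral_mul_le_Lp_mul_Lq μ Real.HolderConjugate.two_two
    (aemeasurable_const (b := (1 : ℝ≥0∞))) hf
  have h2 := pow_le_pow_left₀ zero_le h 2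
  rw [mul_pow, ← ENNReal.rpow_natCast (_ ^ (1 / 2 : ℝ)), ← ENNReal.rpow_natCast (_ ^ (1 / 2 : ℝ)),
    ← ENNReal.rpow_mul, ← ENNReal.rpow_mul] at h2
  simpa using h2

theorem enorm_sq_eq_lintegral {α E : Type*} [MeasurableSpace α] [NormedAddCommGroup E]
    {μ : Measure α} (f : Lp E 2 μ) {g : α → E} (h : f =ᵐ[μ] g) :
    ‖f‖ₑ ^ 2 = ∫⁻ x, ‖g x‖ₑ ^ 2 ∂μ := by
  rw [Lp.enorm_def, eLpNorm_congr_ae h, eLpNorm_eq_lintegral_rpow_enorm_toReal (by simp) (by simp),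
    ← ENNReal.rpow_natCast (_ ^ (1 / _ : ℝ)), ← ENNReal.rpow_mul]
  simp

/-- The increment is the integral of the derivative along the segment, and Jensen on the unit
interval moves the square inside. -/
theorem enorm_translate_sub_sq_le {u : ℂ → ℝ} (hu : ContDiff ℝ 1 u) (x h : ℂ) :
    ‖u (x + h) - u x‖ₑ ^ 2 ≤
      ∫⁻ t in Ioc (0 : ℝ) 1, (‖h‖ₑ * ‖fderiv ℝ u (x + t • h)‖ₑ) ^ 2 := by
  have hc : Continuous fun t : ℝ => fderiv ℝ u (x + t • h) :=
    (hu.continuous_fderiv one_ne_zero).comp (by fun_prop)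
  have hd : ∀ t : ℝ, HasDerivAt (fun t : ℝ => u (x + t • h)) (fderiv ℝ u (x + t • h) h) t := by
    intro t
    have h1 : HasDerivAt (fun t : ℝ => x + t • h) h t := by
      simpa using ((hasDerivAt_id t).smul_const h).const_add x
    exact ((hu.differentiable one_ne_zero _).hasFDerivAt).comp_hasDerivAt t h1
  have hint : u (x + h) - u x = ∫ t in Ioc (0 : ℝ) 1, fderiv ℝ u (x + t • h) h := by
    rw [← intervalIntegral.integral_of_le zero_le_one,
      intervalIntegral.integral_eq_sub_of_hasDerivAt (fun t _ => hd t)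
        ((hc.clm_apply continuous_const).intervalIntegrable _ _)]
    simp
  calc ‖u (x + h) - u x‖ₑ ^ 2
      ≤ (∫⁻ t in Ioc (0 : ℝ) 1, ‖h‖ₑ * ‖fderiv ℝ u (x + t • h)‖ₑ) ^ 2 := by
        rw [hint]
        gcongr
        refine (enorm_integral_le_lintegral_enorm _).trans (lintegral_mono fun t => ?_)
        rw [mul_comm]
        exact ContinuousLinearMap.le_opENorm _ _
    _ ≤ _ := by
        refine (sq_lintegral_le _ ?_).trans (by simp)
        exact (hc.enorm.measurable.const_mul _).aemeasurable

/-- `‖u(· + h) - u‖_{L²} ≤ |h| ‖∇u‖_{L²}`. -/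
theorem lintegral_enorm_translate_sub_sq_le {u : ℂ → ℝ} (hu : ContDiff ℝ 1 u) (h : ℂ) :
    ∫⁻ x, ‖u (x + h) - u x‖ₑ ^ 2 ≤ ‖h‖ₑ ^ 2 * ∫⁻ x, ‖fderiv ℝ u x‖ₑ ^ 2 := by
  have hc := hu.continuous_fderiv one_ne_zero
  calc ∫⁻ x, ‖u (x + h) - u x‖ₑ ^ 2
      ≤ ∫⁻ x, ∫⁻ t in Ioc (0 : ℝ) 1, (‖h‖ₑ * ‖fderiv ℝ u (x + t • h)‖ₑ) ^ 2 :=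
        lintegral_mono fun x => enorm_translate_sub_sq_le hu x h
    _ = ∫⁻ t in Ioc (0 : ℝ) 1, ∫⁻ x, (‖h‖ₑ * ‖fderiv ℝ u (x + t • h)‖ₑ) ^ 2 := by
        refine lintegral_lintegral_swap (Measurable.aemeasurable ?_)
        have : Continuous fun p : ℂ × ℝ => fderiv ℝ u (p.1 + p.2 • h) := hc.comp (by fun_prop)
        exact (this.enorm.measurable.const_mul _).pow_const 2
    _ = ∫⁻ t in Ioc (0 : ℝ) 1, ‖h‖ₑ ^ 2 * ∫⁻ x, ‖fderiv ℝ u x‖ₑ ^ 2 := by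
        refine lintegral_congr fun t => ?_
        simp only [mul_pow]
        rw [lintegral_const_mul' _ _ (by simp),
          lintegral_add_right_eq_self (fun x => ‖fderiv ℝ u x‖ₑ ^ 2) (t • h)]
    _ = _ := by simp

theorem IsTest.enorm_fn_sq {Ω : Set ℂ} {η : ℂ → ℝ} (hη : IsTest Ω η) :
    ‖W012.fn hη.toW012‖ₑ ^ 2 = ∫⁻ z in Ω, ‖η z‖ₑ ^ 2 :=
  enorm_sq_eq_lintegral _ (hη.memLp _).coeFn_toLp

theorem IsTest.enorm_grad_sq {Ω : Set ℂ} {η : ℂ → ℝ} (hη : IsTest Ω η) :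
    ‖W012.grad hη.toW012‖ₑ ^ 2 = ∫⁻ z, ‖fderiv ℝ η z‖ₑ ^ 2 := by
  rw [hη.grad_toW012, enorm_sq_eq_lintegral _ (hη.memLp_gradient _).coeFn_toLp,
    setLIntegral_eq_of_support_subset]
  · refine lintegral_congr fun z => ?_
    rw [← ofReal_norm, ← ofReal_norm, norm_gradient_eq]
  · intro z hz
    by_contra h
    exact hz (by simp [hη.gradient_eq_zero_of_notMem h])

/-- The Poincaré inequality on a bounded open set. -/
theorem exists_poincare_const {Ω : Set ℂ} (hΩ : IsOpen Ω) (hb : Bornology.IsBounded Ω) :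
    ∃ C : ℝ, 0 ≤ C ∧ ∀ u : W012 Ω, ‖W012.fn u‖ ≤ C * ‖W012.grad u‖ := by
  obtain ⟨R, hR, hsub⟩ := hb.subset_ball_lt 0 0
  -- `Ω` lies in a disc of radius `R`, so a shift by `2R` moves every point of `Ω` out of `Ω`, where
  -- test functions vanish.
  refine ⟨2 * R, by positivity, W012.induction_test hΩ ?_ fun η hη => ?_⟩
  · exact isClosed_le (W012.fnL Ω).continuous.norm
      (continuous_const.mul (W012.gradL Ω).continuous.norm)
  have key : ‖W012.fn hη.toW012‖ₑ ^ 2 ≤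
      (ENNReal.ofReal (2 * R) * ‖W012.grad hη.toW012‖ₑ) ^ 2 := by
    rw [hη.enorm_fn_sq, mul_pow, hη.enorm_grad_sq]
    calc ∫⁻ z in Ω, ‖η z‖ₑ ^ 2
        = ∫⁻ z in Ω, ‖η (z + (2 * R : ℝ)) - η z‖ₑ ^ 2 := by
          refine setLIntegral_congr_fun hΩ.measurableSet fun z hz => ?_
          have : z + (2 * R : ℝ) ∉ Ω := by
            intro h
            have h1 := hsub hz
            have h2 := hsub h
            rw [mem_ball_zero_iff] at h1 h2
            have h3 := norm_sub_le (z + (2 * R : ℝ)) z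
            rw [add_sub_cancel_left, Complex.norm_real, Real.norm_of_nonneg (by positivity)] at h3
            linarith
          simp only [hη.eq_zero_of_notMem this, zero_sub, enorm_neg]
      _ ≤ ∫⁻ z, ‖η (z + (2 * R : ℝ)) - η z‖ₑ ^ 2 := setLIntegral_le_lintegral _ _
      _ ≤ _ := by
          refine (lintegral_enorm_translate_sub_sq_le (hη.smooth.of_le (by simp)) _).trans ?_
          rw [← ofReal_norm, Complex.norm_real, Real.norm_of_nonneg (by positivity)]
  have h1 := (ENNReal.pow_le_pow_left_iff two_ne_zero).1 key
  rw [← ofReal_norm, ← ofReal_norm, ← ENNReal.ofReal_mul (by positivity)] at h1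
  exact (ENNReal.ofReal_le_ofReal_iff (by positivity)).1 h1

/-! ### Averages over square cells and Rellich's theorem -/

/-- The left side is the square of the mean of `u x - u y` over `Q`, so Jensen applies. Enlarging
`Q` to a ball leaves a bound independent of the cell, ready for Fubini in `x` and `h`. -/
theorem enorm_sub_average_sq_le {u : ℂ → ℝ} (hu : Continuous u) (hi : Integrable u)
    {Q : Set ℂ} {a r : ℝ} (ha : 0 < a)
    (hvol : volume Q = ENNReal.ofReal a) {x : ℂ} (hr : Q ⊆ Metric.closedBall x r) :
    ‖u x - a⁻¹ * ∫ y in Q, u y‖ₑ ^ 2 ≤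
      ENNReal.ofReal a⁻¹ * ∫⁻ h in Metric.closedBall 0 r, ‖u (x + h) - u x‖ₑ ^ 2 := by
  have hfin : IsFiniteMeasure (volume.restrict Q) := ⟨by simp [hvol]⟩
  have hreal : volume.real Q = a := by
    rw [measureReal_def, hvol, ENNReal.toReal_ofReal ha.le]
  have e : u x - a⁻¹ * ∫ y in Q, u y = a⁻¹ * ∫ y in Q, (u x - u y) := by
    rw [integral_sub (integrable_const _) hi.integrableOn, setIntegral_const, hreal, smul_eq_mul]
    field_simp
  have hc : Continuous fun y => ‖u x - u y‖ₑ := (continuous_const.sub hu).enorm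
  have hball : ∫⁻ y in Metric.closedBall x r, ‖u x - u y‖ₑ ^ 2 =
      ∫⁻ h in Metric.closedBall 0 r, ‖u (x + h) - u x‖ₑ ^ 2 := by
    rw [← lintegral_indicator Metric.isClosed_closedBall.measurableSet,
      ← lintegral_indicator Metric.isClosed_closedBall.measurableSet,
      ← lintegral_add_left_eq_self _ x]
    refine lintegral_congr fun h => ?_
    simp only [indicator, Metric.mem_closedBall, dist_self_add_left, dist_zero_right]
    rw [enorm_sub_rev]
  calc ‖u x - a⁻¹ * ∫ y in Q, u y‖ₑ ^ 2
      ≤ (ENNReal.ofReal a⁻¹ * ∫⁻ y in Q, ‖u x - u y‖ₑ) ^ 2 := by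
        rw [e, enorm_mul, Real.enorm_of_nonneg (by positivity)]
        gcongr
        exact enorm_integral_le_lintegral_enorm _
    _ ≤ ENNReal.ofReal a⁻¹ ^ 2 * (ENNReal.ofReal a * ∫⁻ y in Q, ‖u x - u y‖ₑ ^ 2) := by
        rw [mul_pow]
        gcongr
        simpa [hvol] using sq_lintegral_le (volume.restrict Q) hc.measurable.aemeasurable
    _ = ENNReal.ofReal a⁻¹ * ∫⁻ y in Q, ‖u x - u y‖ₑ ^ 2 := by
        rw [← mul_assoc, pow_two, mul_assoc (ENNReal.ofReal a⁻¹),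
          ← ENNReal.ofReal_mul (by positivity),
          inv_mul_cancel₀ ha.ne', ENNReal.ofReal_one, mul_one]
    _ ≤ _ := by
        rw [← hball]
        gcongr

/-- The half-open square of side `ε` with lower left corner `ε p`. -/
def cell (ε : ℝ) (p : ℤ × ℤ) : Set ℂ :=
  {z | ⌊z.re / ε⌋ = p.1 ∧ ⌊z.im / ε⌋ = p.2}

theorem cell_eq {ε : ℝ} (hε : 0 < ε) (p : ℤ × ℤ) :
    cell ε p = Ico (p.1 * ε) ((p.1 + 1) * ε) ×ℂ Ico (p.2 * ε) ((p.2 + 1) * ε) := by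
  ext z
  simp only [cell, mem_ofPred_eq, Int.floor_eq_iff, Complex.mem_reProdIm, mem_Ico, le_div_iff₀ hε,
    div_lt_iff₀ hε]

theorem measurableSet_cell {ε : ℝ} (hε : 0 < ε) (p : ℤ × ℤ) : MeasurableSet (cell ε p) := by
  rw [cell_eq hε]
  exact (measurableSet_Ico.preimage Complex.measurable_re).inter
    (measurableSet_Ico.preimage Complex.measurable_im)

theorem volume_cell {ε : ℝ} (hε : 0 < ε) (p : ℤ × ℤ) :
    volume (cell ε p) = ENNReal.ofReal (ε ^ 2) := by
  have : cell ε p = Complex.measurableEquivRealProd ⁻¹'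
      (Ico (p.1 * ε) ((p.1 + 1) * ε) ×ˢ Ico (p.2 * ε) ((p.2 + 1) * ε)) := by
    rw [cell_eq hε]
    ext z
    simp [Complex.mem_reProdIm]
  rw [this, Complex.volume_preserving_equiv_real_prod.measure_preimage
    (measurableSet_Ico.prod measurableSet_Ico).nullMeasurableSet, Measure.volume_eq_prod,
    Measure.prod_prod, Real.volume_Ico, Real.volume_Ico, ← ENNReal.ofReal_mul (by linarith)]
  congr 1
  ring

theorem cell_subset_closedBall {ε : ℝ} (hε : 0 < ε) {p : ℤ × ℤ} {x : ℂ} (hx : x ∈ cell ε p) :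
    cell ε p ⊆ Metric.closedBall x (2 * ε) := by
  intro y hy
  rw [cell_eq hε, Complex.mem_reProdIm] at hx hy
  rw [Metric.mem_closedBall, dist_eq_norm]
  refine (Complex.norm_le_abs_re_add_abs_im _).trans ?_
  rw [Complex.sub_re, Complex.sub_im]
  have h1 : |y.re - x.re| ≤ ε := by
    rw [abs_le]; constructor <;> linarith [hx.1.1, hx.1.2, hy.1.1, hy.1.2]
  have h2 : |y.im - x.im| ≤ ε := by
    rw [abs_le]; constructor <;> linarith [hx.2.1, hx.2.2, hy.2.1, hy.2.2]
  linarith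

theorem exists_finset_cell {Ω : Set ℂ} (hb : Bornology.IsBounded Ω) {ε : ℝ} (hε : 0 < ε) :
    ∃ S : Finset (ℤ × ℤ), ∀ z ∈ Ω, (⌊z.re / ε⌋, ⌊z.im / ε⌋) ∈ S := by
  obtain ⟨R, hR, hsub⟩ := hb.subset_ball_lt 0 0
  refine ⟨Finset.Icc ⌊-R / ε⌋ ⌊R / ε⌋ ×ˢ Finset.Icc ⌊-R / ε⌋ ⌊R / ε⌋, fun z hz => ?_⟩
  have hz := (mem_ball_zero_iff.1 (hsub hz)).le
  have h1 := abs_le.1 ((Complex.abs_re_le_norm z).trans hz)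
  have h2 := abs_le.1 ((Complex.abs_im_le_norm z).trans hz)
  simp only [Finset.mem_product, Finset.mem_Icc]
  refine ⟨⟨?_, ?_⟩, ?_, ?_⟩ <;> refine Int.floor_mono (div_le_div_of_nonneg_right ?_ hε.le)
  exacts [h1.1, h1.2, h2.1, h2.2]

/-- The indicator of a cell, as an element of `L²(Ω)`. -/
noncomputable def cellIndicator (Ω : Set ℂ) {ε : ℝ} (hε : 0 < ε) (p : ℤ × ℤ) : L2 Ω :=
  indicatorConstLp 2 (measurableSet_cell hε p)
    ((Measure.restrict_le_self _).trans_lt (by simp [volume_cell hε])).ne (1 : ℝ)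

/-- Averaging over the cells in a finite set. -/
noncomputable def cellAverage (Ω : Set ℂ) {ε : ℝ} (hε : 0 < ε) (S : Finset (ℤ × ℤ)) :
    L2 Ω →L[ℝ] L2 Ω :=
  ∑ p ∈ S, (ε ^ 2)⁻¹ • (innerSL ℝ (cellIndicator Ω hε p)).smulRight (cellIndicator Ω hε p)

theorem isCompactOperator_cellAverage (Ω : Set ℂ) {ε : ℝ} (hε : 0 < ε) (S : Finset (ℤ × ℤ)) :
    IsCompactOperator (cellAverage Ω hε S) := by
  have : cellAverage Ω hε S ∈ compactOperator (RingHom.id ℝ) (L2 Ω) (L2 Ω) := by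
    refine Submodule.sum_mem _ fun p _ => Submodule.smul_mem _ _ ?_
    exact (isCompactOperator_of_locallyCompactSpace_dom
      (innerSL ℝ (cellIndicator Ω hε p))).clm_comp
      (ContinuousLinearMap.toSpanSingleton ℝ (cellIndicator Ω hε p))
  exact this

/-- The cells partition the plane, so only the one containing `z` contributes. Its integral may run
beyond `Ω` because `η` vanishes there. -/
theorem cellAverage_toW012 {Ω : Set ℂ} (hΩ : IsOpen Ω) {ε : ℝ} (hε : 0 < ε)
    {S : Finset (ℤ × ℤ)} (hS : ∀ z ∈ Ω, (⌊z.re / ε⌋, ⌊z.im / ε⌋) ∈ S) {η : ℂ → ℝ}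
    (hη : IsTest Ω η) :
    cellAverage Ω hε S (W012.fn hη.toW012) =ᵐ[volume.restrict Ω] fun z =>
      (ε ^ 2)⁻¹ * ∫ y in cell ε (⌊z.re / ε⌋, ⌊z.im / ε⌋), η y := by
  have hinner : ∀ p, inner ℝ (cellIndicator Ω hε p) (W012.fn hη.toW012) = ∫ y in cell ε p, η y := by
    intro p
    rw [cellIndicator, L2.inner_indicatorConstLp_one, hη.fn_toW012]
    rw [setIntegral_congr_ae (g := η) (measurableSet_cell hε p)
      ((hη.memLp (volume.restrict Ω)).coeFn_toLp.mono fun _ h _ => h),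
      Measure.restrict_restrict (measurableSet_cell hε p), ← setIntegral_indicator hΩ.measurableSet]
    congr 1
    ext z
    by_cases hz : z ∈ Ω
    · simp [hz]
    · simp [hz, hη.eq_zero_of_notMem hz]
  have hsum : cellAverage Ω hε S (W012.fn hη.toW012) =
      ∑ p ∈ S, ((ε ^ 2)⁻¹ * ∫ y in cell ε p, η y) • cellIndicator Ω hε p := by
    rw [cellAverage, sum_apply]
    refine Finset.sum_congr rfl fun p _ => ?_
    rw [← hinner]
    simp [mul_smul]
  rw [hsum]
  have hcoe : ∀ᵐ z ∂(volume.restrict Ω), ∀ p ∈ S,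
      (((ε ^ 2)⁻¹ * ∫ y in cell ε p, η y) • cellIndicator Ω hε p : L2 Ω) z =
      (cell ε p).indicator (fun _ => (ε ^ 2)⁻¹ * ∫ y in cell ε p, η y) z := by
    rw [Filter.eventually_all_finset]
    intro p _
    filter_upwards [Lp.coeFn_smul ((ε ^ 2)⁻¹ * ∫ y in cell ε p, η y) (cellIndicator Ω hε p),
      indicatorConstLp_coeFn (p := 2) (hs := measurableSet_cell hε p)
      (hμs := ((Measure.restrict_le_self _).trans_lt (by simp [volume_cell hε])).ne)
      (c := (1 : ℝ)) (μ := volume.restrict Ω)] with z h1 h2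
    rw [h1, Pi.smul_apply, cellIndicator, h2]
    by_cases hz : z ∈ cell ε p <;> simp [hz]
  filter_upwards [hcoe, Lp.coeFn_finsetSum S
    (fun p => ((ε ^ 2)⁻¹ * ∫ y in cell ε p, η y) • cellIndicator Ω hε p),
    ae_restrict_mem hΩ.measurableSet] with z h1 h2 hz
  rw [h2, Finset.sum_apply, Finset.sum_congr rfl h1,
    Finset.sum_eq_single_of_mem _ (hS z hz)]
  · rw [indicator_of_mem]
    exact ⟨rfl, rfl⟩
  · intro p _ hp
    rw [indicator_of_notMem]
    rintro ⟨h1, h2⟩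
    exact hp (Prod.ext h1.symm h2.symm)

/-- Within a cell only translations of length at most `2ε` occur; Fubini and the translation
estimate bound each of them by the gradient. -/
theorem norm_fn_sub_cellAverage_le {Ω : Set ℂ} (hΩ : IsOpen Ω) {ε : ℝ} (hε : 0 < ε)
    {S : Finset (ℤ × ℤ)} (hS : ∀ z ∈ Ω, (⌊z.re / ε⌋, ⌊z.im / ε⌋) ∈ S) (u : W012 Ω) :
    ‖W012.fn u - cellAverage Ω hε S (W012.fn u)‖ ≤ (8 * ε) * ‖W012.grad u‖ := by
  revert u
  refine W012.induction_test hΩ ?_ fun η hη => ?_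
  · exact isClosed_le ((W012.fnL Ω).continuous.sub
      ((cellAverage Ω hε S).continuous.comp (W012.fnL Ω).continuous)).norm
      (continuous_const.mul (W012.gradL Ω).continuous.norm)
  have hC1 : ContDiff ℝ 1 η := hη.smooth.of_le (by simp)
  have hcont := hη.smooth.continuous
  have hi : Integrable η := hcont.integrable_of_hasCompactSupport hη.compact
  have hsub : (W012.fn hη.toW012 - cellAverage Ω hε S (W012.fn hη.toW012) : L2 Ω)
      =ᵐ[volume.restrict Ω] fun z =>
        η z - (ε ^ 2)⁻¹ * ∫ y in cell ε (⌊z.re / ε⌋, ⌊z.im / ε⌋), η y :=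
    (Lp.coeFn_sub _ _).trans
      ((hη.memLp (volume.restrict Ω)).coeFn_toLp.sub (cellAverage_toW012 hΩ hε hS hη))
  have key : ‖W012.fn hη.toW012 - cellAverage Ω hε S (W012.fn hη.toW012)‖ₑ ^ 2 ≤
      (ENNReal.ofReal (8 * ε) * ‖W012.grad hη.toW012‖ₑ) ^ 2 := by
    rw [enorm_sq_eq_lintegral _ hsub, mul_pow, hη.enorm_grad_sq]
    calc _ ≤ ∫⁻ z in Ω, ENNReal.ofReal (ε ^ 2)⁻¹ *
            ∫⁻ h in Metric.closedBall 0 (2 * ε), ‖η (z + h) - η z‖ₑ ^ 2 := by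
          refine lintegral_mono fun z => ?_
          exact enorm_sub_average_sq_le hcont hi (by positivity)
            (volume_cell hε _) (cell_subset_closedBall hε ⟨rfl, rfl⟩)
      _ ≤ ENNReal.ofReal (ε ^ 2)⁻¹ *
            ∫⁻ z, ∫⁻ h in Metric.closedBall 0 (2 * ε), ‖η (z + h) - η z‖ₑ ^ 2 := by
          rw [lintegral_const_mul' _ _ (by simp)]
          exact mul_le_mul_right (setLIntegral_le_lintegral _ _) _
      _ = ENNReal.ofReal (ε ^ 2)⁻¹ *
            ∫⁻ h in Metric.closedBall 0 (2 * ε), ∫⁻ z, ‖η (z + h) - η z‖ₑ ^ 2 := by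
          rw [lintegral_lintegral_swap (Measurable.aemeasurable ?_)]
          have : Continuous fun p : ℂ × ℂ => η (p.1 + p.2) - η p.1 := by fun_prop
          exact this.enorm.measurable.pow_const 2
      _ ≤ ENNReal.ofReal (ε ^ 2)⁻¹ * ∫⁻ _ in Metric.closedBall (0 : ℂ) (2 * ε),
            ENNReal.ofReal (2 * ε) ^ 2 * ∫⁻ z, ‖fderiv ℝ η z‖ₑ ^ 2 := by
          gcongr ENNReal.ofReal (ε ^ 2)⁻¹ * ?_
          refine setLIntegral_mono' Metric.isClosed_closedBall.measurableSet fun h hh => ?_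
          refine (lintegral_enorm_translate_sub_sq_le hC1 h).trans ?_
          gcongr
          rw [← ofReal_norm]
          exact ENNReal.ofReal_le_ofReal (mem_closedBall_zero_iff.1 hh)
      _ ≤ _ := by
          rw [setLIntegral_const, Complex.volume_closedBall, mul_comm (_ * _ : ℝ≥0∞) (_ * _),
            ← mul_assoc,
            ← mul_assoc]
          gcongr
          rw [← ENNReal.ofReal_coe_nnreal, ← ENNReal.ofReal_pow (by positivity),
            ← ENNReal.ofReal_pow (by positivity), ← ENNReal.ofReal_mul (by positivity),
            ← ENNReal.ofReal_mul (by positivity), ← ENNReal.ofReal_mul (by positivity)]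
          -- The constants multiply to `ε⁻² · (2ε)² · π(2ε)² = 16πε²`, at most `(8ε)²` since `π ≤
          -- 4`.
          refine ENNReal.ofReal_le_ofReal ?_
          rw [NNReal.coe_real_pi]
          field_simp
          nlinarith [Real.pi_le_four, sq_nonneg ε]
  have h1 := (ENNReal.pow_le_pow_left_iff two_ne_zero).1 key
  rw [← ofReal_norm, ← ofReal_norm, ← ENNReal.ofReal_mul (by positivity)] at h1
  exact (ENNReal.ofReal_le_ofReal_iff (by positivity)).1 h1

theorem isCompactOperator_of_norm_sub_le {X Y : Type*} [SeminormedAddCommGroup X]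
    [NormedSpace ℝ X] [NormedAddCommGroup Y] [NormedSpace ℝ Y] [CompleteSpace Y] {f : X →L[ℝ] Y}
    {F : ℕ → X →L[ℝ] Y} {ε : ℕ → ℝ} (hε : Filter.Tendsto ε Filter.atTop (𝓝 0))
    (hε0 : ∀ n, 0 ≤ ε n) (hF : ∀ n, IsCompactOperator (F n))
    (h : ∀ n x, ‖f x - F n x‖ ≤ ε n * ‖x‖) : IsCompactOperator f := by
  refine isCompactOperator_of_tendsto (l := Filter.atTop) (F := F) ?_
    (Filter.Eventually.of_forall hF)
  rw [tendsto_iff_norm_sub_tendsto_zero]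
  refine squeeze_zero (fun _ => norm_nonneg _) (fun n => ?_) hε
  refine ContinuousLinearMap.opNorm_le_bound _ (hε0 n) fun u => ?_
  rw [sub_apply, norm_sub_rev]
  exact h n u

/-- Rellich's theorem: the inclusion `W₀^{1,2}(Ω) → L²(Ω)` is compact for bounded `Ω`. -/
theorem isCompactOperator_fnL {Ω : Set ℂ} (hΩ : IsOpen Ω) (hb : Bornology.IsBounded Ω) :
    IsCompactOperator (W012.fnL Ω) := by
  have hε : ∀ n : ℕ, (0 : ℝ) < 1 / ((n : ℝ) + 1) := fun n => Nat.one_div_pos_of_nat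
  choose S hS using fun n => exists_finset_cell hb (hε n)
  have hlim : Filter.Tendsto (fun n : ℕ => 8 * (1 / ((n : ℝ) + 1))) Filter.atTop (𝓝 0) := by
    simpa using (tendsto_one_div_add_atTop_nhds_zero_nat (𝕜 := ℝ)).const_mul 8
  refine @isCompactOperator_of_norm_sub_le (W012 Ω) (L2 Ω) inferInstance inferInstance _ _ _ _
    (fun n => (cellAverage Ω (hε n) (S n)).comp (W012.fnL Ω)) _ hlim
    (fun n => mul_nonneg (by norm_num) (hε n).le)
    (fun n => (isCompactOperator_cellAverage Ω (hε n) (S n)).comp_clm (W012.fnL Ω)) fun n u => ?_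
  refine (norm_fn_sub_cellAverage_le hΩ (hε n) (hS n) u).trans ?_
  gcongr
  exact (le_add_of_nonneg_left (norm_nonneg _)).trans_eq (W012.norm_eq u).symm

/-! ### Extremals of compact operators and the first eigenvalue -/

/-- A nonzero compact operator between real Hilbert spaces attains its norm, at an eigenvector of
`J* J`. -/
theorem exists_inner_map_map_eq_of_isCompactOperator {E F : Type*} [NormedAddCommGroup E]
    [InnerProductSpace ℝ E] [CompleteSpace E] [NormedAddCommGroup F] [InnerProductSpace ℝ F]
    [CompleteSpace F] (J : E →L[ℝ] F) (hJ : IsCompactOperator J) (hJ0 : J ≠ 0) :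
    ∃ x : E, x ≠ 0 ∧ ∀ y, inner ℝ (J x) (J y) = ‖J‖ ^ 2 * inner ℝ x y := by
  have hpos : 0 < ‖J‖ := norm_pos_iff.2 hJ0
  set κ : ℝ := ‖J‖ ^ 2 with hκ
  have hκpos : 0 < κ := by positivity
  let T : E →L[ℝ] E := (ContinuousLinearMap.adjoint J).comp J
  have hT : IsCompactOperator T := hJ.clm_comp (ContinuousLinearMap.adjoint J)
  have hTinner : ∀ x y, inner ℝ (T x) y = inner ℝ (J x) (J y) := fun x y =>
    ContinuousLinearMap.adjoint_inner_left J y (J x)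
  have hx : ∀ n : ℕ, ∃ x : E, ‖x‖ < 1 ∧ ‖J‖ - 1 / ((n : ℝ) + 1) < ‖J x‖ := fun n =>
    J.exists_lt_apply_of_lt_opNorm (sub_lt_self _ Nat.one_div_pos_of_nat)
  choose x hx1 hxJ using hx
  have hJx : Filter.Tendsto (fun n => ‖J (x n)‖) Filter.atTop (𝓝 ‖J‖) := by
    refine tendsto_of_tendsto_of_tendsto_of_le_of_le
      (by simpa using (tendsto_one_div_add_atTop_nhds_zero_nat (𝕜 := ℝ)).const_sub ‖J‖)
      tendsto_const_nhds (fun n => (hxJ n).le) fun n => ?_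
    calc ‖J (x n)‖ ≤ ‖J‖ * ‖x n‖ := J.le_opNorm _
      _ ≤ ‖J‖ * 1 := by gcongr; exact (hx1 n).le
      _ = ‖J‖ := mul_one _
  -- Expanding the square gives `‖Tx‖² - 2κ‖Jx‖² + κ²‖x‖²`, with `‖Tx‖² ≤ κ‖Jx‖²` and `‖x‖ ≤ 1`.
  -- Hence a maximizing sequence consists of approximate eigenvectors.
  have hest : ∀ n, ‖T (x n) - κ • x n‖ ^ 2 ≤ κ * κ - κ * ‖J (x n)‖ ^ 2 := by
    intro n
    have h1 : ‖T (x n)‖ ≤ ‖J‖ * ‖J (x n)‖ := by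
      have := (ContinuousLinearMap.adjoint J).le_opNorm (J (x n))
      rwa [LinearIsometryEquiv.norm_map] at this
    have h2 : ‖T (x n)‖ ^ 2 ≤ κ * ‖J (x n)‖ ^ 2 := by
      rw [hκ, ← mul_pow]
      exact pow_le_pow_left₀ (norm_nonneg _) h1 2
    have h3 : ‖x n‖ ^ 2 ≤ 1 := pow_le_one₀ (norm_nonneg _) (hx1 n).le
    rw [norm_sub_sq_real, real_inner_smul_right, hTinner, real_inner_self_eq_norm_sq, norm_smul,
      mul_pow, Real.norm_of_nonneg hκpos.le]
    nlinarith [mul_le_mul_of_nonneg_left h3 (mul_self_nonneg κ)]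
  have hdiff : Filter.Tendsto (fun n => T (x n) - κ • x n) Filter.atTop (𝓝 0) := by
    rw [tendsto_zero_iff_norm_tendsto_zero]
    have h0 : Filter.Tendsto (fun n => κ * κ - κ * ‖J (x n)‖ ^ 2) Filter.atTop (𝓝 0) := by
      have := ((hJx.pow 2).const_mul κ).const_sub (κ * κ)
      rwa [← hκ, sub_self] at this
    have h1 := squeeze_zero (fun n => sq_nonneg _) hest h0
    have h2 := h1.sqrt
    simpa [Real.sqrt_sq (norm_nonneg _)] using h2
  obtain ⟨K, hK, hTK⟩ :=
    IsCompactOperator.image_closedBall_subset_compact (f := (T : E →ₗ[ℝ] E)) hT 1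
  obtain ⟨y, -, ns, hns, hlim⟩ := hK.tendsto_subseq (x := fun n => T (x n)) fun n =>
    hTK ⟨x n, mem_closedBall_zero_iff.2 (hx1 n).le, rfl⟩
  -- Since `κx = Tx - (Tx - κx)`, convergence of `T (x n)` along a subsequence forces convergence of
  -- `x n` itself.
  have hxlim : Filter.Tendsto (x ∘ ns) Filter.atTop (𝓝 (κ⁻¹ • y)) := by
    have h1 := (hlim.sub (hdiff.comp hns.tendsto_atTop)).const_smul κ⁻¹
    simpa [Function.comp_def, smul_smul, inv_mul_cancel₀ hκpos.ne'] using h1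
  have hJlim : ‖J (κ⁻¹ • y)‖ = ‖J‖ :=
    tendsto_nhds_unique ((J.continuous.tendsto _).comp hxlim).norm (hJx.comp hns.tendsto_atTop)
  have hTx : T (κ⁻¹ • y) = κ • κ⁻¹ • y := by
    rw [smul_inv_smul₀ hκpos.ne']
    exact tendsto_nhds_unique ((T.continuous.tendsto _).comp hxlim) hlim
  refine ⟨κ⁻¹ • y, ?_, fun v => ?_⟩
  · intro h
    rw [h, map_zero, norm_zero] at hJlim
    exact hpos.ne hJlim
  · rw [← hTinner, hTx, real_inner_smul_left]

/-- Maximisation of the quotient `‖f u‖ / ‖G u‖` for a compact `f` and a bounded below `G`. -/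
theorem exists_extremal_of_isCompactOperator {X E F : Type*} [NormedAddCommGroup X]
    [NormedSpace ℝ X] [CompleteSpace X] [NormedAddCommGroup E] [InnerProductSpace ℝ E]
    [CompleteSpace E] [NormedAddCommGroup F] [InnerProductSpace ℝ F] [CompleteSpace F]
    (G : X →L[ℝ] E) (f : X →L[ℝ] F) (hf : IsCompactOperator f) (hf0 : f ≠ 0) (C : ℝ)
    (hG : ∀ x, ‖x‖ ≤ C * ‖G x‖) :
    ∃ κ : ℝ, 0 < κ ∧ (∀ y, ‖f y‖ ≤ κ * ‖G y‖) ∧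
      ∃ x, x ≠ 0 ∧ ∀ y, inner ℝ (f x) (f y) = κ ^ 2 * inner ℝ (G x) (G y) := by
  have hanti : AntilipschitzWith C.toNNReal G := by
    refine G.antilipschitz_of_bound fun x => (hG x).trans ?_
    gcongr
    exact Real.le_coe_toNNReal C
  have hclosed : IsClosed (range G) := hanti.isClosed_range G.uniformContinuous
  let e := G.equivRange hanti.injective hclosed
  have hcomp : CompleteSpace G.range := hclosed.completeSpace_coe
  -- `X` is only a Banach space; passing to the closed range of `G` supplies the inner product
  -- needed for `J* J`.
  let J : G.range →L[ℝ] F := f.comp (e.symm : G.range →L[ℝ] X)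
  have hJe : ∀ x, J (e x) = f x := fun x => by simp [J]
  have hJ0 : J ≠ 0 := by
    intro h
    refine hf0 (ContinuousLinearMap.ext fun x => ?_)
    rw [← hJe, h]
    rfl
  obtain ⟨x, hx0, hx⟩ := exists_inner_map_map_eq_of_isCompactOperator J
    (hf.comp_clm (e.symm : G.range →L[ℝ] X)) hJ0
  have hJpos : 0 < ‖J‖ := by
    refine lt_of_le_of_ne (ContinuousLinearMap.opNorm_nonneg J) fun h => hJ0 ?_
    refine ContinuousLinearMap.ext fun y => norm_le_zero_iff.1 ?_
    have hy := J.le_opNorm y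
    rwa [← h, zero_mul] at hy
  refine ⟨‖J‖, hJpos, fun y => ?_, e.symm x, ?_, fun y => ?_⟩
  · rw [← hJe]
    exact J.le_opNorm (e y)
  · simpa using hx0
  · have h1 : G (e.symm x) = (x : E) := congrArg Subtype.val (e.apply_symm_apply x)
    rw [← hJe, ← hJe y, e.apply_symm_apply, hx, h1]
    rfl

/-- A bump function at a point of `Ω` is continuous and nonzero there, hence not almost everywhere
zero. -/
theorem fnL_ne_zero {Ω : Set ℂ} (hΩ : IsOpen Ω) (hne : Ω.Nonempty) : W012.fnL Ω ≠ 0 := by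
  obtain ⟨z, hz⟩ := hne
  obtain ⟨η, h1, h2, h3, -, h5⟩ := exists_contDiff_tsupport_subset (n := ⊤) (hΩ.mem_nhds hz)
  have hη : IsTest Ω η := ⟨h3, h2, h1⟩
  intro h
  have h0 : W012.fn hη.toW012 = 0 := by rw [← W012.fnL_apply, h]; rfl
  have hae : η =ᵐ[volume.restrict Ω] fun _ => 0 := by
    rw [hη.fn_toW012] at h0
    exact (hη.memLp _).coeFn_toLp.symm.trans (h0 ▸ Lp.coeFn_zero ℝ 2 (volume.restrict Ω))
  have := Measure.eqOn_open_of_ae_eq hae hΩ hη.smooth.continuous.continuousOn continuousOn_const hz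
  rw [h5] at this
  exact one_ne_zero this

/-- On a bounded open set the first Dirichlet eigenvalue is `κ⁻²`, where `κ` is the best constant
in the Poincaré inequality. -/
theorem exists_isLeast_poincare {Ω : Set ℂ} (hΩ : IsOpen Ω) (hb : Bornology.IsBounded Ω)
    (hne : Ω.Nonempty) : ∃ κ : ℝ, 0 < κ ∧
      IsLeast {μ : ℝ | IsDirichletEigenvalue Ω μ} (κ ^ 2)⁻¹ ∧
      IsLeast {K : ℝ | ∀ g : W012 Ω, ‖W012.fn g‖ ≤ K * ‖W012.grad g‖} κ := by
  obtain ⟨C, hC, hP⟩ := exists_poincare_const hΩ hb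
  have hbelow : ∀ u : W012 Ω, ‖u‖ ≤ (C + 1) * ‖W012.gradL Ω u‖ := fun u => by
    rw [W012.norm_eq, add_mul, one_mul]
    exact add_le_add_left (hP u) _
  obtain ⟨κ, hκ, hle, x, hx0, hx⟩ := @exists_extremal_of_isCompactOperator (W012 Ω) (L2Vec Ω) (L2 Ω)
    inferInstance inferInstance _ _ _ _ _ _ _ (W012.gradL Ω) (W012.fnL Ω)
    (isCompactOperator_fnL hΩ hb) (fnL_ne_zero hΩ hne) (C + 1) hbelow
  have hfn : ∀ u v : W012 Ω, ∫ z in Ω, W012.fn u z * W012.fn v z =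
      inner ℝ (W012.fn u) (W012.fn v) := fun u v => by
    rw [L2.inner_def]
    refine integral_congr_ae (Filter.Eventually.of_forall fun z => ?_)
    simp [mul_comm]
  have hgrad : ∀ u v : W012 Ω, ∫ z in Ω, inner ℝ (W012.grad u z) (W012.grad v z) =
      inner ℝ (W012.grad u) (W012.grad v) := fun u v => (L2.inner_def _ _).symm
  have hpos : ∀ u : W012 Ω, u ≠ 0 → 0 < ‖W012.grad u‖ := fun u hu => by
    refine (norm_nonneg _).lt_of_ne fun h => hu ?_
    have := hbelow u
    rw [W012.gradL_apply, ← h, mul_zero] at this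
    exact norm_le_zero_iff.1 this
  refine ⟨κ, hκ, ⟨⟨x, hx0, fun v => ?_⟩, ?_⟩, hle, fun K hK => ?_⟩
  · rw [hfn, hgrad]
    have := hx v
    simp only [W012.fnL_apply, W012.gradL_apply] at this
    rw [this, inv_mul_cancel_left₀ (by positivity)]
  · rintro μ ⟨g, hg0, hg⟩
    have h1 := hg g
    rw [hfn, hgrad, real_inner_self_eq_norm_sq, real_inner_self_eq_norm_sq] at h1
    have h2 := hpos g hg0
    have h3 : ‖W012.fn g‖ ^ 2 ≤ κ ^ 2 * ‖W012.grad g‖ ^ 2 := by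
      rw [← mul_pow]
      exact pow_le_pow_left₀ (norm_nonneg _) (hle g) 2
    have hμ : 0 < μ := by
      by_contra h
      have := mul_nonpos_of_nonpos_of_nonneg (not_lt.1 h) (sq_nonneg ‖W012.fn g‖)
      have : 0 < ‖W012.grad g‖ ^ 2 := by positivity
      linarith
    have h4 : 1 * ‖W012.grad g‖ ^ 2 ≤ (μ * κ ^ 2) * ‖W012.grad g‖ ^ 2 := by
      nlinarith [mul_le_mul_of_nonneg_left h3 hμ.le]
    have h5 := le_of_mul_le_mul_right h4 (by positivity)
    rw [inv_le_iff_one_le_mul₀ (by positivity)]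
    exact h5
  · have h1 := hx x
    simp only [W012.fnL_apply, W012.gradL_apply] at h1
    rw [real_inner_self_eq_norm_sq, real_inner_self_eq_norm_sq, ← mul_pow] at h1
    have h2 := hpos x hx0
    have h3 : ‖W012.fn x‖ = κ * ‖W012.grad x‖ :=
      (sq_eq_sq₀ (norm_nonneg _) (by positivity)).1 h1
    have h4 := hK x
    rw [h3] at h4
    exact le_of_mul_le_mul_right h4 h2

/-! ### Conformal maps: analytic inverse and nonvanishing derivative -/

theorem zero_mem_disc : (0 : ℂ) ∈ disc := Metric.mem_ball_self one_pos

theorem IsConformalOnto.not_constant {φ : ℂ → ℂ} {Ω : Set ℂ} (hφ : IsConformalOnto φ Ω) (w : ℂ) :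
    ¬ ∀ z ∈ disc, φ z = w := by
  intro h
  have hmem : (1 / 2 : ℂ) ∈ disc := by
    rw [mem_ball_zero_iff]
    norm_num
  have := hφ.bij.injOn zero_mem_disc hmem ((h _ zero_mem_disc).trans (h _ hmem).symm)
  norm_num at this

theorem IsConformalOnto.isOpen_image {φ : ℂ → ℂ} {Ω : Set ℂ} (hφ : IsConformalOnto φ Ω)
    {s : Set ℂ} (hs : s ⊆ disc) (ho : IsOpen s) : IsOpen (φ '' s) := by
  rcases (hφ.holo.analyticOnNhd Metric.isOpen_ball).is_constant_or_isOpen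
    (convex_ball (0 : ℂ) 1).isPreconnected with ⟨w, hw⟩ | h
  · exact absurd hw (hφ.not_constant w)
  · exact h s hs ho

/-- A conformal map as a partial homeomorphism. -/
noncomputable def IsConformalOnto.homeo {φ : ℂ → ℂ} {Ω : Set ℂ} (hφ : IsConformalOnto φ Ω) :
    OpenPartialHomeomorph ℂ ℂ :=
  OpenPartialHomeomorph.ofContinuousOpenRestrict (BijOn.toPartialEquiv φ disc Ω hφ.bij)
    hφ.holo.continuousOn
    (fun s hs => by
      have : (disc.domRestrict φ) '' s = φ '' (Subtype.val '' s) := by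
        rw [image_image]
        rfl
      change IsOpen ((disc.domRestrict φ) '' s)
      rw [this]
      exact hφ.isOpen_image (by rintro _ ⟨x, -, rfl⟩; exact x.2)
        (Metric.isOpen_ball.isOpenMap_subtype_val s hs))
    Metric.isOpen_ball

theorem IsConformalOnto.hasDerivAt {φ : ℂ → ℂ} {Ω : Set ℂ} (hφ : IsConformalOnto φ Ω)
    {z : ℂ} (hz : z ∈ disc) : HasDerivAt φ (deriv φ z) z :=
  (hφ.holo.differentiableAt (Metric.isOpen_ball.mem_nhds hz)).hasDerivAt

theorem IsConformalOnto.eventually_deriv_ne_zero {φ : ℂ → ℂ} {Ω : Set ℂ} (hφ : IsConformalOnto φ Ω)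
    {z : ℂ} (hz : z ∈ disc) :
    ∀ᶠ w in 𝓝[≠] z, deriv φ w ≠ 0 := by
  have ha : AnalyticOnNhd ℂ (deriv φ) disc := (hφ.holo.analyticOnNhd Metric.isOpen_ball).deriv
  refine (ha z hz).eventually_eq_zero_or_eventually_ne_zero.resolve_left fun h => ?_
  have hpre := (convex_ball (0 : ℂ) 1).isPreconnected
  have h0 := ha.eqOn_zero_of_preconnected_of_eventuallyEq_zero hpre hz h
  exact hφ.not_constant (φ 0) fun w hw =>
    Metric.isOpen_ball.is_const_of_deriv_eq_zero hpre hφ.holo h0 hw zero_mem_disc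

/-- Zeros of `φ'` are isolated, so the inverse is differentiable on a punctured neighbourhood; being
continuous, it has a removable singularity. Nonvanishing of `φ'` is not presupposed, but follows
from this. -/
theorem IsConformalOnto.analyticAt_homeo_symm {φ : ℂ → ℂ} {Ω : Set ℂ} (hφ : IsConformalOnto φ Ω)
    {w : ℂ} (hw : w ∈ Ω) :
    AnalyticAt ℂ hφ.homeo.symm w := by
  have hcont : ContinuousAt hφ.homeo.symm w := hφ.homeo.continuousAt_symm hw
  refine Complex.analyticAt_of_differentiable_on_punctured_nhds_of_continuousAt ?_ hcont
  have hz : hφ.homeo.symm w ∈ disc := hφ.homeo.map_target hw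
  have hΩ : Ω ∈ 𝓝 w := hφ.homeo.open_target.mem_nhds hw
  have htend : Filter.Tendsto hφ.homeo.symm (𝓝[≠] w) (𝓝[≠] (hφ.homeo.symm w)) := by
    refine tendsto_nhdsWithin_iff.2 ⟨hcont.tendsto.mono_left nhdsWithin_le_nhds, ?_⟩
    filter_upwards [self_mem_nhdsWithin, mem_nhdsWithin_of_mem_nhds hΩ] with v hv hvΩ heq
    exact hv (hφ.homeo.symm.injOn hvΩ hw heq)
  filter_upwards [htend.eventually (hφ.eventually_deriv_ne_zero hz),
    mem_nhdsWithin_of_mem_nhds hΩ] with v hv hvΩ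
  exact (hφ.homeo.hasDerivAt_symm hvΩ hv
    (hφ.hasDerivAt (hφ.homeo.map_target hvΩ))).differentiableAt

/-- The derivative of a conformal map has no zeros. -/
theorem IsConformalOnto.deriv_ne_zero {φ : ℂ → ℂ} {Ω : Set ℂ} (hφ : IsConformalOnto φ Ω)
    {z : ℂ} (hz : z ∈ disc) : deriv φ z ≠ 0 := by
  intro h
  have h1 := (hφ.analyticAt_homeo_symm (hφ.bij.mapsTo hz)).differentiableAt.hasDerivAt
  have h2 := h1.comp z (hφ.hasDerivAt hz)
  have h3 : hφ.homeo.symm ∘ φ =ᶠ[𝓝 z] id := by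
    filter_upwards [Metric.isOpen_ball.mem_nhds hz] with w hw
    exact hφ.homeo.left_inv hw
  have h4 := h2.unique ((hasDerivAt_id z).congr_of_eventuallyEq h3)
  rw [h, mul_zero] at h4
  exact zero_ne_one h4

/-! ### Conformal change of variables -/

/-- The pull-back of a test function by a partial homeomorphism analytic on its source. -/
theorem IsTest.indicator_comp {e : OpenPartialHomeomorph ℂ ℂ}
    (he : ∀ z ∈ e.source, AnalyticAt ℂ e z) {η : ℂ → ℝ} (hη : IsTest e.target η) :
    IsTest e.source (e.source.indicator (η ∘ e)) := by
  have hK : IsCompact (e.symm '' tsupport η) :=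
    hη.compact.isCompact.image_of_continuousOn (e.continuousOn_symm.mono hη.supp)
  have hsub : e.symm '' tsupport η ⊆ e.source := by
    rintro _ ⟨w, hw, rfl⟩
    exact e.map_target (hη.supp hw)
  have hsupp : tsupport (e.source.indicator (η ∘ e)) ⊆ e.symm '' tsupport η := by
    refine closure_minimal (fun z hz => ?_) hK.isClosed
    have hz1 : z ∈ e.source := by
      by_contra h
      exact hz (indicator_of_notMem h _)
    refine ⟨e z, subset_tsupport _ ?_, e.left_inv hz1⟩
    rwa [Function.mem_support, indicator_of_mem hz1] at hz
  refine ⟨contDiff_iff_contDiffAt.2 fun z => ?_, hK.of_isClosed_subset (isClosed_tsupport _) hsupp,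
    hsupp.trans hsub⟩
  by_cases hz : z ∈ e.source
  · have h1 : ContDiffAt ℝ ∞ (η ∘ e) z :=
      hη.smooth.contDiffAt.comp z ((he z hz).contDiffAt.restrict_scalars ℝ)
    refine h1.congr_of_eventuallyEq ?_
    filter_upwards [e.open_source.mem_nhds hz] with w hw
    exact indicator_of_mem hw _
  · refine (contDiffAt_const (c := (0 : ℝ))).congr_of_eventuallyEq ?_
    exact notMem_tsupport_iff_eventuallyEq.1 fun h => hz (hsub (hsupp h))

/-- Multiplication by `a ≠ 0` is a similarity: submultiplicativity for `a` and for `a⁻¹` gives the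
two inequalities. -/
theorem norm_comp_smul_one (L : ℂ →L[ℝ] ℝ) (a : ℂ) :
    ‖L.comp (a • (1 : ℂ →L[ℝ] ℂ))‖ = ‖a‖ * ‖L‖ := by
  have hle : ∀ (M : ℂ →L[ℝ] ℝ) (b : ℂ), ‖M.comp (b • (1 : ℂ →L[ℝ] ℂ))‖ ≤ ‖b‖ * ‖M‖ := by
    intro M b
    refine (M.opNorm_comp_le _).trans ?_
    rw [norm_smul, norm_one, mul_one, mul_comm]
  refine le_antisymm (hle L a) ?_
  rcases eq_or_ne a 0 with rfl | ha
  · simp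
  · have h1 := hle (L.comp (a • (1 : ℂ →L[ℝ] ℂ))) a⁻¹
    have h2 : (L.comp (a • (1 : ℂ →L[ℝ] ℂ))).comp (a⁻¹ • (1 : ℂ →L[ℝ] ℂ)) = L := by
      ext z
      simp [ha]
    rw [h2, norm_inv] at h1
    have ha' : 0 < ‖a‖ := norm_pos_iff.2 ha
    calc ‖a‖ * ‖L‖ ≤ ‖a‖ * (‖a‖⁻¹ * ‖L.comp (a • (1 : ℂ →L[ℝ] ℂ))‖) := by gcongr
      _ = _ := by rw [mul_inv_cancel_left₀ ha'.ne']

theorem det_smul_one (a : ℂ) : (a • (1 : ℂ →L[ℝ] ℂ)).det = ‖a‖ ^ 2 := by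
  have : ((a • (1 : ℂ →L[ℝ] ℂ) : ℂ →L[ℝ] ℂ) : ℂ →ₗ[ℝ] ℂ) = LinearMap.mulLeft ℝ a := by
    ext
    simp
  rw [ContinuousLinearMap.det, this, ← Complex.normSq_eq_norm_sq, ← Algebra.norm_complex_apply]
  rfl

/-- The Dirichlet integral is conformally invariant. -/
theorem IsConformalOnto.norm_grad_eq {φ : ℂ → ℂ} {Ω : Set ℂ} (hφ : IsConformalOnto φ Ω)
    {η θ : ℂ → ℝ} (hη : IsTest disc η) (hθ : IsTest Ω θ) (h : ∀ z ∈ disc, η z = θ (φ z)) :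
    ‖W012.grad hη.toW012‖ = ‖W012.grad hθ.toW012‖ := by
  have hzero : ∀ {U : Set ℂ} {ζ : ℂ → ℝ}, IsTest U ζ → (Function.support fun z =>
      ‖fderiv ℝ ζ z‖ₑ ^ 2) ⊆ U := by
    intro U ζ hζ z hz
    by_contra hzU
    have := hζ.gradient_eq_zero_of_notMem hzU
    rw [← norm_eq_zero, norm_gradient_eq] at this
    refine hz ?_
    simp only
    rw [← ofReal_norm, this, ENNReal.ofReal_zero, zero_pow two_ne_zero]
  have key : ‖W012.grad hη.toW012‖ₑ ^ 2 = ‖W012.grad hθ.toW012‖ₑ ^ 2 := by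
    rw [hη.enorm_grad_sq, hθ.enorm_grad_sq, ← setLIntegral_eq_of_support_subset (hzero hη),
      ← setLIntegral_eq_of_support_subset (hzero hθ)]
    rw [← hφ.bij.image_eq, lintegral_image_eq_lintegral_abs_det_fderiv_mul volume
      Metric.isOpen_ball.measurableSet
      (fun z hz => (hφ.hasDerivAt hz).complexToReal_fderiv.hasFDerivWithinAt) hφ.bij.injOn]
    refine setLIntegral_congr_fun Metric.isOpen_ball.measurableSet fun z hz => ?_
    have h1 : HasFDerivAt (θ ∘ φ) ((fderiv ℝ θ (φ z)).comp (deriv φ z • (1 : ℂ →L[ℝ] ℂ))) z :=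
      (hθ.smooth.differentiable (by simp) (φ z)).hasFDerivAt.comp z
        (hφ.hasDerivAt hz).complexToReal_fderiv
    have h2 : η =ᶠ[𝓝 z] θ ∘ φ := by
      filter_upwards [Metric.isOpen_ball.mem_nhds hz] with w hw
      exact h w hw
    rw [(h1.congr_of_eventuallyEq h2).fderiv, ← ofReal_norm, norm_comp_smul_one, det_smul_one,
      ENNReal.ofReal_mul (norm_nonneg _), mul_pow, ofReal_norm, ofReal_norm,
      abs_of_nonneg (sq_nonneg _),
      ENNReal.ofReal_pow (norm_nonneg _), ofReal_norm]
  have := (ENNReal.pow_right_strictMono two_ne_zero).injective key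
  rw [← ofReal_norm, ← ofReal_norm] at this
  exact (ENNReal.ofReal_eq_ofReal_iff (norm_nonneg _) (norm_nonneg _)).1 this

theorem measurable_weight (φ : ℂ → ℂ) :
    Measurable fun z => ENNReal.ofReal (‖deriv φ z‖ ^ 2) :=
  ((measurable_deriv φ).norm.pow_const 2).ennreal_ofReal

/-- The density is positive throughout the disc because `φ'` has no zeros there. -/
theorem ae_of_ae_weightedMeasure {φ : ℂ → ℂ} {Ω : Set ℂ} (hφ : IsConformalOnto φ Ω)
    {p : ℂ → Prop} (h : ∀ᵐ z ∂(weightedMeasure φ), p z) : ∀ᵐ z ∂(volume.restrict disc), p z := by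
  rw [weightedMeasure, ae_withDensity_iff (measurable_weight φ)] at h
  filter_upwards [h, ae_restrict_mem Metric.isOpen_ball.measurableSet] with z hz hzd
  refine hz ?_
  have := norm_pos_iff.2 (hφ.deriv_ne_zero hzd)
  simpa using this

theorem weightedMeasure_absolutelyContinuous (φ : ℂ → ℂ) :
    weightedMeasure φ ≪ volume.restrict disc :=
  withDensity_absolutelyContinuous _ _

/-- A conformal map transports the measure `|φ'|² dx dy` to the Lebesgue measure. -/
theorem IsConformalOnto.measurePreserving {φ : ℂ → ℂ} {Ω : Set ℂ} (hφ : IsConformalOnto φ Ω) :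
    MeasurePreserving (disc.indicator φ) (weightedMeasure φ) (volume.restrict Ω) := by
  -- `φ` is arbitrary off the disc; cutting it to zero there makes it measurable on the plane.
  have hEq : EqOn (disc.indicator φ) φ disc := fun z hz => indicator_of_mem hz _
  refine ⟨?_, ?_⟩
  · classical
    rw [← piecewise_eq_indicator]
    exact ContinuousOn.measurable_piecewise hφ.holo.continuousOn continuous_zero.continuousOn
      Metric.isOpen_ball.measurableSet
  · have h := map_withDensity_abs_det_fderiv_eq_addHaar volume
      (f := disc.indicator φ) (f' := fun z => deriv φ z • (1 : ℂ →L[ℝ] ℂ))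
      (Metric.isOpen_ball.measurableSet (s := disc)).nullMeasurableSet
      (fun z hz => (hφ.hasDerivAt hz).complexToReal_fderiv.hasFDerivWithinAt.congr hEq (hEq hz))
      (hφ.bij.injOn.congr hEq.symm)
    rw [hEq.image_eq, hφ.bij.image_eq] at h
    rw [← h, weightedMeasure]
    simp only [det_smul_one, abs_pow, abs_norm]

theorem IsConformalOnto.ae_comp {φ : ℂ → ℂ} {Ω : Set ℂ} (hφ : IsConformalOnto φ Ω)
    {p : ℂ → Prop} (h : ∀ᵐ w ∂(volume.restrict Ω), p w) :
    ∀ᵐ z ∂(volume.restrict disc), p (φ z) := by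
  have h1 := ae_of_ae_weightedMeasure hφ (hφ.measurePreserving.quasiMeasurePreserving.ae h)
  filter_upwards [h1, ae_restrict_mem Metric.isOpen_ball.measurableSet] with z hz hzd
  rwa [indicator_of_mem hzd] at hz

theorem IsConformalOnto.exists_push_test {φ : ℂ → ℂ} {Ω : Set ℂ} (hφ : IsConformalOnto φ Ω)
    {η : ℂ → ℝ} (hη : IsTest disc η) :
    ∃ θ, IsTest Ω θ ∧ ∀ z ∈ disc, η z = θ (φ z) := by
  refine ⟨_, IsTest.indicator_comp (e := hφ.homeo.symm)
    (fun w hw => hφ.analyticAt_homeo_symm hw) hη, fun z hz => ?_⟩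
  exact (congrArg η (hφ.homeo.left_inv hz).symm).trans
    (indicator_of_mem (hφ.bij.mapsTo hz) (η ∘ hφ.homeo.symm)).symm

theorem IsConformalOnto.exists_pull_test {φ : ℂ → ℂ} {Ω : Set ℂ} (hφ : IsConformalOnto φ Ω)
    {θ : ℂ → ℝ} (hθ : IsTest Ω θ) :
    ∃ η, IsTest disc η ∧ ∀ z ∈ disc, η z = θ (φ z) :=
  ⟨_, IsTest.indicator_comp (e := hφ.homeo)
    (fun z hz => hφ.holo.analyticOnNhd Metric.isOpen_ball z hz) hθ,
    fun _ hz => indicator_of_mem hz _⟩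

theorem IsConformalOnto.fn_ae_eq_of_test {φ : ℂ → ℂ} {Ω : Set ℂ} (hφ : IsConformalOnto φ Ω)
    {η θ : ℂ → ℝ} (hη : IsTest disc η) (hθ : IsTest Ω θ) (h : ∀ z ∈ disc, η z = θ (φ z)) :
    ∀ᵐ z ∂(volume.restrict disc), W012.fn hη.toW012 z = W012.fn hθ.toW012 (φ z) := by
  filter_upwards [(hη.memLp (volume.restrict disc)).coeFn_toLp,
    hφ.ae_comp (hθ.memLp (volume.restrict Ω)).coeFn_toLp,
    ae_restrict_mem Metric.isOpen_ball.measurableSet] with z h1 h2 hz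
  rw [hη.fn_toW012, hθ.fn_toW012, h1, h2, h z hz]

/-! ### Transport of `W₀^{1,2}` and the weighted embedding -/

theorem W012.dist_eq {Ω : Set ℂ} (u v : W012 Ω) :
    dist u v = ‖W012.fn (u - v)‖ + ‖W012.grad (u - v)‖ :=
  (dist_eq_norm u v).trans (W012.norm_eq _)

/-- Every element of `W₀^{1,2}(𝔻)` is `g ∘ φ` for some `g ∈ W₀^{1,2}(Ω)` with the same Dirichlet
integral. -/
theorem IsConformalOnto.exists_push {φ : ℂ → ℂ} {Ω : Set ℂ} (hφ : IsConformalOnto φ Ω)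
    (hΩ : IsOpen Ω) (hb : Bornology.IsBounded Ω) (f : W012 disc) :
    ∃ g : W012 Ω, ‖W012.grad g‖ = ‖W012.grad f‖ ∧
      ∀ᵐ z ∂(volume.restrict disc), W012.fn f z = W012.fn g (φ z) := by
  obtain ⟨C, hC, hP⟩ := exists_poincare_const hΩ hb
  obtain ⟨η, hη, hlim⟩ := W012.exists_seq_test Metric.isOpen_ball f
  choose θ hθ hηθ using fun n => hφ.exists_push_test (hη n)
  -- Differences have equal gradient norms on both sides, and Poincaré on `Ω` bounds the full norm
  -- by `C + 1` times that of the gradient.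
  have hdist : ∀ n m, dist (hθ n).toW012 (hθ m).toW012 ≤
      (C + 1) * dist (hη n).toW012 (hη m).toW012 := by
    intro n m
    have hgrad := hφ.norm_grad_eq ((hη n).sub (hη m)) ((hθ n).sub (hθ m)) fun z hz => by
      rw [Pi.sub_apply, Pi.sub_apply, hηθ n z hz, hηθ m z hz]
    rw [W012.dist_eq, W012.dist_eq, (hη n).toW012_sub Metric.isOpen_ball (hη m) ((hη n).sub (hη m)),
      (hθ n).toW012_sub hΩ (hθ m) ((hθ n).sub (hθ m))]
    have h1 := hP ((hθ n).sub (hθ m)).toW012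
    rw [← hgrad] at h1 ⊢
    nlinarith [mul_nonneg (add_nonneg hC zero_le_one)
      (norm_nonneg (W012.fn ((hη n).sub (hη m)).toW012))]
  have hcauchy : CauchySeq fun n => (hθ n).toW012 := by
    rw [Metric.cauchySeq_iff']
    intro ε hε
    obtain ⟨N, hN⟩ := Metric.cauchySeq_iff'.1 hlim.cauchySeq (ε / (C + 1)) (by positivity)
    refine ⟨N, fun n hn => (hdist n N).trans_lt ?_⟩
    rw [← lt_div_iff₀' (by positivity)]
    exact hN n hn
  obtain ⟨g, hg⟩ := cauchySeq_tendsto_of_complete hcauchy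
  refine ⟨g, ?_, ?_⟩
  · refine tendsto_nhds_unique (((W012.gradL Ω).continuous.tendsto g).comp hg).norm ?_
    refine ((((W012.gradL disc).continuous.tendsto f).comp hlim).norm).congr fun n => ?_
    exact hφ.norm_grad_eq (hη n) (hθ n) (hηθ n)
  -- Both `L²` limits are realized almost everywhere along one subsequence: `ms` is extracted from
  -- the sequence already thinned by `ns`.
  · obtain ⟨ns, hns, h1⟩ := (tendstoInMeasure_of_tendsto_Lp
      (((W012.fnL disc).continuous.tendsto f).comp hlim)).exists_seq_tendsto_ae
    obtain ⟨ms, hms, h2⟩ := (tendstoInMeasure_of_tendsto_Lp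
      ((((W012.fnL Ω).continuous.tendsto g).comp hg).comp
        hns.tendsto_atTop)).exists_seq_tendsto_ae
    filter_upwards [h1, hφ.ae_comp h2, ae_all_iff.2 fun n =>
      hφ.fn_ae_eq_of_test (hη n) (hθ n) (hηθ n)] with z hz1 hz2 hz3
    refine tendsto_nhds_unique (hz1.comp hms.tendsto_atTop) (hz2.congr fun n => ?_)
    exact (hz3 _).symm

theorem IsConformalOnto.fn_ae_eq_compMeasurePreserving {φ : ℂ → ℂ} {Ω : Set ℂ}
    (hφ : IsConformalOnto φ Ω) {f : W012 disc} {g : L2 Ω}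
    (h : ∀ᵐ z ∂(volume.restrict disc), W012.fn f z = g (φ z)) :
    W012.fn f =ᵐ[weightedMeasure φ]
      Lp.compMeasurePreserving (disc.indicator φ) hφ.measurePreserving g := by
  filter_upwards [(weightedMeasure_absolutelyContinuous φ).ae_le h,
    (weightedMeasure_absolutelyContinuous φ).ae_le
      (ae_restrict_mem Metric.isOpen_ball.measurableSet),
    Lp.coeFn_compMeasurePreserving g hφ.measurePreserving] with z h1 h2 h3
  rw [h1, h3, Function.comp_apply, indicator_of_mem h2]

theorem IsConformalOnto.memLp_fn {φ : ℂ → ℂ} {Ω : Set ℂ} (hφ : IsConformalOnto φ Ω)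
    (hΩ : IsOpen Ω) (hb : Bornology.IsBounded Ω) (f : W012 disc) :
    MemLp (W012.fn f) 2 (weightedMeasure φ) := by
  obtain ⟨g, -, hg⟩ := hφ.exists_push hΩ hb f
  exact (memLp_congr_ae (hφ.fn_ae_eq_compMeasurePreserving hg)).2 (Lp.memLp _)

/-- The embedding `W₀^{1,2}(𝔻) → L²(𝔻, h)` as a linear map. -/
noncomputable def IsConformalOnto.embeddingₗ {φ : ℂ → ℂ} {Ω : Set ℂ} (hφ : IsConformalOnto φ Ω)
    (hΩ : IsOpen Ω) (hb : Bornology.IsBounded Ω) : W012 disc →ₗ[ℝ] L2Weighted φ where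
  toFun f := (hφ.memLp_fn hΩ hb f).toLp (W012.fn f)
  map_add' f g := by
    rw [← MemLp.toLp_add]
    exact MemLp.toLp_congr _ _ ((weightedMeasure_absolutelyContinuous φ).ae_le
      (Lp.coeFn_add (W012.fn f) (W012.fn g)))
  map_smul' c f := by
    rw [RingHom.id_apply, ← MemLp.toLp_const_smul]
    exact MemLp.toLp_congr _ _ ((weightedMeasure_absolutelyContinuous φ).ae_le
      (Lp.coeFn_smul c (W012.fn f)))

/-- This is the factorization through `L²(Ω)`: norms are then read off from the isometry
`Lp.compMeasurePreserving`. -/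
theorem IsConformalOnto.embeddingₗ_eq {φ : ℂ → ℂ} {Ω : Set ℂ} (hφ : IsConformalOnto φ Ω)
    (hΩ : IsOpen Ω) (hb : Bornology.IsBounded Ω) {f : W012 disc} {g : L2 Ω}
    (h : ∀ᵐ z ∂(volume.restrict disc), W012.fn f z = g (φ z)) :
    hφ.embeddingₗ hΩ hb f =
      Lp.compMeasurePreserving (disc.indicator φ) hφ.measurePreserving g :=
  Lp.ext ((MemLp.coeFn_toLp (hφ.memLp_fn hΩ hb f)).trans (hφ.fn_ae_eq_compMeasurePreserving h))

theorem IsConformalOnto.embeddingₗ_ae_eq {φ : ℂ → ℂ} {Ω : Set ℂ} (hφ : IsConformalOnto φ Ω)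
    (hΩ : IsOpen Ω) (hb : Bornology.IsBounded Ω) (f : W012 disc) :
    hφ.embeddingₗ hΩ hb f =ᵐ[volume.restrict disc] W012.fn f :=
  ae_of_ae_weightedMeasure hφ (MemLp.coeFn_toLp (hφ.memLp_fn hΩ hb f))

theorem IsConformalOnto.norm_embeddingₗ_le {φ : ℂ → ℂ} {Ω : Set ℂ} (hφ : IsConformalOnto φ Ω)
    (hΩ : IsOpen Ω) (hb : Bornology.IsBounded Ω) {K : ℝ}
    (hK : ∀ g : W012 Ω, ‖W012.fn g‖ ≤ K * ‖W012.grad g‖) (f : W012 disc) :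
    ‖hφ.embeddingₗ hΩ hb f‖ ≤ K * ‖W012.grad f‖ := by
  obtain ⟨g, hgrad, hg⟩ := hφ.exists_push hΩ hb f
  rw [hφ.embeddingₗ_eq hΩ hb hg, Lp.norm_compMeasurePreserving, ← hgrad]
  exact hK g

/-- Pulling a test function on `Ω` back to the disc preserves both norms, and density does the rest.
This makes the constant on the disc sharp. -/
theorem IsConformalOnto.norm_fn_le_of_norm_embeddingₗ_le {φ : ℂ → ℂ} {Ω : Set ℂ}
    (hφ : IsConformalOnto φ Ω) (hΩ : IsOpen Ω) (hb : Bornology.IsBounded Ω) {K : ℝ}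
    (hK : ∀ f : W012 disc, ‖hφ.embeddingₗ hΩ hb f‖ ≤ K * ‖W012.grad f‖) (g : W012 Ω) :
    ‖W012.fn g‖ ≤ K * ‖W012.grad g‖ := by
  revert g
  refine W012.induction_test hΩ ?_ fun θ hθ => ?_
  · exact isClosed_le (W012.fnL Ω).continuous.norm
      (continuous_const.mul (W012.gradL Ω).continuous.norm)
  obtain ⟨η, hη, h⟩ := hφ.exists_pull_test hθ
  have h1 := hK hη.toW012
  rwa [hφ.embeddingₗ_eq hΩ hb (hφ.fn_ae_eq_of_test hη hθ h), Lp.norm_compMeasurePreserving,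
    hφ.norm_grad_eq hη hθ h] at h1

theorem IsConformalOnto.isCompactOperator_embeddingₗ {φ : ℂ → ℂ} {Ω : Set ℂ}
    (hφ : IsConformalOnto φ Ω) (hΩ : IsOpen Ω) (hb : Bornology.IsBounded Ω) :
    IsCompactOperator (hφ.embeddingₗ hΩ hb) := by
  obtain ⟨C, hC, hP⟩ := exists_poincare_const hΩ hb
  obtain ⟨S, hS, hmem⟩ := isCompactOperator_fnL hΩ hb
  obtain ⟨δ, hδ, hball⟩ := Metric.mem_nhds_iff.1 hmem
  -- The radius `δ / (C + 1)` ensures, through Poincaré, that the transported function lies in the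
  -- `δ`-ball which the inclusion sends into the compact set `S`.
  refine ⟨Lp.compMeasurePreserving (disc.indicator φ) hφ.measurePreserving '' S,
    hS.image (Lp.isometry_compMeasurePreserving hφ.measurePreserving).continuous,
    Filter.mem_of_superset (Metric.ball_mem_nhds 0 (show 0 < δ / (C + 1) by positivity))
      fun f hf => ?_⟩
  obtain ⟨g, hgrad, hg⟩ := hφ.exists_push hΩ hb f
  refine ⟨W012.fn g, hball ?_, (hφ.embeddingₗ_eq hΩ hb hg).symm⟩
  rw [Metric.mem_ball, W012.dist_eq, sub_zero] at hf ⊢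
  rw [lt_div_iff₀ (by positivity)] at hf
  have h1 := hP g
  rw [hgrad] at h1 ⊢
  nlinarith [mul_nonneg hC (norm_nonneg (W012.fn f)), norm_nonneg (W012.fn f)]

theorem IsConformalOnto.norm_embeddingₗ_le_norm {φ : ℂ → ℂ} {Ω : Set ℂ}
    (hφ : IsConformalOnto φ Ω) (hΩ : IsOpen Ω) (hb : Bornology.IsBounded Ω) {K : ℝ} (hK0 : 0 ≤ K)
    (hK : ∀ g : W012 Ω, ‖W012.fn g‖ ≤ K * ‖W012.grad g‖) (f : W012 disc) :
    ‖hφ.embeddingₗ hΩ hb f‖ ≤ K * ‖f‖ := by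
  refine (hφ.norm_embeddingₗ_le hΩ hb hK f).trans (mul_le_mul_of_nonneg_left ?_ hK0)
  exact (le_add_of_nonneg_left (norm_nonneg _)).trans_eq (W012.norm_eq f).symm

end PlaneSobolev

theorem theorem1 (Ω : Set ℂ) (hΩ_open : IsOpen Ω) (hΩ_bdd : Bornology.IsBounded Ω)
    (hΩ_sc : IsSimplyConnected Ω) (φ : ℂ → ℂ) (hφ : IsConformalOnto φ Ω) :
    -- `λ₁[Ω]` is a positive number and is the smallest Dirichlet eigenvalue
    0 < lambda1 Ω ∧
    IsLeast {μ : ℝ | IsDirichletEigenvalue Ω μ} (lambda1 Ω) ∧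
    -- exact constant in the Poincaré inequality on `Ω`
    IsLeast {K : ℝ | ∀ g : W012 Ω, ‖W012.fn g‖ ≤ K * ‖W012.grad g‖} (1 / √(lambda1 Ω)) ∧
    -- the embedding `W₀^{1,2}(𝔻) → L²(𝔻, h)` is well defined and compact,
    -- with the same exact constant
    ∃ i : W012 disc →L[ℝ] L2Weighted φ,
      (∀ f : W012 disc, i f =ᵐ[volume.restrict disc] W012.fn f) ∧
      IsCompactOperator i ∧
      IsLeast {K : ℝ | ∀ f : W012 disc, ‖i f‖ ≤ K * ‖W012.grad f‖} (1 / √(lambda1 Ω)) := by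
  obtain ⟨κ, hκ, hleast, hbest⟩ := exists_isLeast_poincare hΩ_open hΩ_bdd hΩ_sc.nonempty
  have hlam : lambda1 Ω = (κ ^ 2)⁻¹ := hleast.csInf_eq
  have hK : 1 / √(lambda1 Ω) = κ := by
    rw [hlam, Real.sqrt_inv, Real.sqrt_sq hκ.le, one_div, inv_inv]
  rw [hK, hlam]
  refine ⟨by positivity, hleast, hbest,
    (hφ.embeddingₗ hΩ_open hΩ_bdd).mkContinuous κ
      (hφ.norm_embeddingₗ_le_norm hΩ_open hΩ_bdd hκ.le hbest.1),
    hφ.embeddingₗ_ae_eq hΩ_open hΩ_bdd, hφ.isCompactOperator_embeddingₗ hΩ_open hΩ_bdd,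
    hφ.norm_embeddingₗ_le hΩ_open hΩ_bdd hbest.1, fun K hKi => ?_⟩
  exact hbest.2 (hφ.norm_fn_le_of_norm_embeddingₗ_le hΩ_open hΩ_bdd hKi)
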